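/- For integers $1\le k\le n$ and $p\in(0,1)$ let $\mathcal H_{n,k,p}$ be the $k$-uniform binomial random hypergraph on the vertex set $[n]=\{1,\dots,n\}$: each $k$-subset of $[n]$ is an edge with probability $p$, independently of the others. For $S\subseteq[n]$ with $|S|<k$ let the codegree $X_S$ be the number of edges of $\mathcal H_{n,k,p}$ that contain $S$. For $d,N\in\mathbb N$ with $d\ge 2$ and $p\in(0,1)$ put \[ a(d,N,p)=pN+\sqrt{2Np(1-p)\log d}\left(1-\frac{\log\log d}{4\log d}-\frac{\log(2\sqrt\pi)}{2\log d}\right),\qquad b(d,N,p)=\sqrt{\frac{Np(1-p)}{2\log d}}. \] Write $f(n)\ll g(n)$ or $g(n)\gg f(n)$ for $f(n)=o(g(n))$ as $n\to\infty$. Theorem. Let $p=p(n)\in(0,1)$, $s=s(n)\in\{1,\dots,n-1\}$ and $k=k(n)\in\{s+1,\dots,n\}$ (for all sufficiently large $n$) be such that \[ \binom{n-s}{k-s}p(1-p)\gg s^3\log^3 n,\qquad (k-s)s^2\ll \frac{n-s}{\log^2 n}. \] Let $a_n=a\left(\binom ns,\binom{n-s}{k-s},p\right)$ and $b_n=b\left(\binom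 ns,\binom{n-s}{k-s},p\right)$. Then, as $n\to\infty$, \[ \frac{\max_{S\subseteq[n],\,|S|=s}X_S-a_n}{b_n} \] converges in distribution to a standard Gumbel random variable, that is, to the law on $\mathbb R$ with distribution function $x\mapsto e^{-e^{-x}}$. -/

import Mathlib

open MeasureTheory ProbabilityTheory Filter Asymptotics
open scoped Topology unitInterval

namespace RandomHypergraph

/-- The law of the `k`-uniform binomial random hypergraph on the vertex set `Fin n`: a hypergraph
is identified with its set of edges, every `k`-subset of the vertices is an edge with probability
`p`, independently of the others, and no other set is an edge. -/
noncomputable def binomialRandom (n k : ℕ) (p : I) : Measure (Set (Finset (Fin n))) :=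
  setBernoulli {e : Finset (Fin n) | e.card = k} p

instance (n k : ℕ) (p : I) : IsProbabilityMeasure (binomialRandom n k p) := by
  unfold binomialRandom; infer_instance

/-- The codegree of a set `S` of vertices: the number of edges that contain `S`. -/
noncomputable def codegree {n : ℕ} (H : Set (Finset (Fin n))) (S : Finset (Fin n)) : ℕ :=
  {e | e ∈ H ∧ S ⊆ e}.ncard

/-- The maximum codegree over all sets of exactly `s` vertices
(the maximum is over a non-empty family whenever `s ≤ n`). -/
noncomputable def maxCodegree {n : ℕ} (s : ℕ) (H : Set (Finset (Fin n))) : ℕ :=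
  ((Finset.univ : Finset (Fin n)).powersetCard s).sup (codegree H)

/-- The centring constant for the maximum of `d` binomial `(N, p)` variables. -/
noncomputable def centring (d N : ℕ) (p : ℝ) : ℝ :=
  p * N + √(2 * N * p * (1 - p) * Real.log d) *
    (1 - Real.log (Real.log d) / (4 * Real.log d)
      - Real.log (2 * √Real.pi) / (2 * Real.log d))

/-- The scaling constant for the maximum of `d` binomial `(N, p)` variables. -/
noncomputable def scaling (d N : ℕ) (p : ℝ) : ℝ :=
  √(N * p * (1 - p) / (2 * Real.log d))

/-- The distribution function `x ↦ exp (-exp (-x))` of the standard Gumbel law. -/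
noncomputable def gumbelCDF : StieltjesFunction ℝ where
  toFun x := Real.exp (-Real.exp (-x))
  mono' x y h := by
    simp only [Real.exp_le_exp, neg_le_neg_iff]
    exact h
  right_continuous' x := by
    apply Continuous.continuousWithinAt
    fun_prop

theorem gumbelCDF_apply (x : ℝ) : gumbelCDF x = Real.exp (-Real.exp (-x)) := rfl

theorem tendsto_gumbelCDF_atBot : Tendsto gumbelCDF atBot (𝓝 0) :=
  Real.tendsto_exp_neg_atTop_nhds_zero.comp
    (Real.tendsto_exp_atTop.comp tendsto_neg_atBot_atTop)

theorem tendsto_gumbelCDF_atTop : Tendsto gumbelCDF atTop (𝓝 1) := by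
  have h : Tendsto (fun x : ℝ => Real.exp (-Real.exp (-x))) atTop (𝓝 (Real.exp (-0))) :=
    (Real.continuous_exp.tendsto _).comp Real.tendsto_exp_neg_atTop_nhds_zero.neg
  rw [neg_zero, Real.exp_zero] at h
  exact h

/-- The standard Gumbel law, the law on `ℝ` with distribution function `gumbelCDF`. -/
noncomputable def gumbelMeasure : Measure ℝ := gumbelCDF.measure

instance : IsProbabilityMeasure gumbelMeasure :=
  gumbelCDF.isProbabilityMeasure tendsto_gumbelCDF_atBot tendsto_gumbelCDF_atTop

theorem cdf_gumbelMeasure (x : ℝ) : cdf gumbelMeasure x = Real.exp (-Real.exp (-x)) := by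
  rw [gumbelMeasure, cdf_measure_stieltjesFunction _ tendsto_gumbelCDF_atBot
    tendsto_gumbelCDF_atTop, gumbelCDF_apply]

end RandomHypergraph

/-! The codegree of an `s`-set `S` counts the random edges inside the family of `k`-sets containing
`S`. It is a binomial variable with `N = C(n-s,k-s)` trials and variance `v = Np(1-p)`, and there
are `d = C(n,s)` such variables. Were they independent, the Gumbel limit would follow from `d · P(X
> a + bx) → exp(-x)`.

This one-variable asymptotic is a moderate deviation estimate. Stirling's formula gives the local
limit theorem (`binomial_local_limit`), and comparing the tail with a geometric series gives the
Gaussian tail (`binomial_moderate_deviation`). The threshold lies about `√(2 log d)` standard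
deviations above the mean, so the cubic error vanishes when `log³ d = o(v)`; the first hypothesis
ensures this, since `log d ≤ s log n`.

Dependence comes only from shared edges. Two families share at most a fraction `(k-s)/(n-s)` of
their members, and the second hypothesis makes this `o(1/log² d)`. Fix `r` families. In each one,
the count on the part shared with the others deviates from its mean by `ε b` with probability
`o(d^{-r})`, by Chernoff's bound. Off the shared parts the families are disjoint, so the remaining
counts are independent; passing to them and back moves the threshold by at most `2εb`
(`joint_tail_le`, `le_joint_tail`). Letting `ε → 0`, the `r`-th binomial moment of the number of
exceedances tends to `exp(-x)^r / r!` (`tendsto_binomialMoment_hitCount`).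

These are the moments of a Poisson law of mean `exp(-x)`. Bonferroni's inequalities then show that
no exceedance occurs with probability tending to `exp(-exp(-x))`, which is the limiting distribution
function of the normalised maximum. -/

/-! ### Local limit theorem for the binomial law -/

/-- The probability that a binomial `(N, p)` variable equals `j`. -/
noncomputable def binomialWeight (N : ℕ) (p : ℝ) (j : ℕ) : ℝ :=
  (N.choose j : ℝ) * p ^ j * (1 - p) ^ (N - j)

theorem binomialWeight_nonneg {N : ℕ} {p : ℝ} (h0 : 0 ≤ p) (h1 : p ≤ 1) (j : ℕ) :
    0 ≤ binomialWeight N p j := by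
  have : 0 ≤ 1 - p := by linarith
  unfold binomialWeight; positivity

theorem factorial_eq_stirlingSeq_mul {n : ℕ} (hn : n ≠ 0) :
    (n.factorial : ℝ) = Stirling.stirlingSeq n * (√(2 * n) * (n / Real.exp 1) ^ n) := by
  have : (0 : ℝ) < n := by positivity
  rw [Stirling.stirlingSeq, div_mul_cancel₀]
  positivity

theorem exp_neg_nat_mul_log {x : ℝ} (hx : 0 < x) (m : ℕ) :
    Real.exp (-(m * Real.log x)) = (x⁻¹) ^ m := by
  rw [← mul_neg, ← Real.log_inv, Real.exp_nat_mul, Real.exp_log (by positivity)]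

/-- The relative entropy of the empirical frequencies of `m` successes and `l` failures. -/
noncomputable def binomialEntropy (m l : ℕ) (p : ℝ) : ℝ :=
  m * Real.log (m / ((m + l) * p)) + l * Real.log (l / ((m + l) * (1 - p)))

/-- The identity is exact: the powers of `e` cancel, the powers of `m`, `l`, `m + l`, `p`, `1 - p`
assemble into the entropy, and Stirling's error stays in the `stirlingSeq` factors, each tending to
`√π`. -/
theorem binomialWeight_eq_stirling {m l : ℕ} {p : ℝ} (hm : m ≠ 0) (hl : l ≠ 0) (h0 : 0 < p)
    (h1 : p < 1) :
    binomialWeight (m + l) p m =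
      Stirling.stirlingSeq (m + l) / (Stirling.stirlingSeq m * Stirling.stirlingSeq l) *
        √((m + l) / (2 * m * l)) * Real.exp (-binomialEntropy m l p) := by
  have hq : 0 < 1 - p := by linarith
  have hm' : (0 : ℝ) < m := by positivity
  have hl' : (0 : ℝ) < l := by positivity
  have hml : (0 : ℝ) < (m : ℝ) + l := by positivity
  have hs : ∀ n : ℕ, n ≠ 0 → Stirling.stirlingSeq n ≠ 0 := by
    intro n hn h
    have := Stirling.sqrt_pi_le_stirlingSeq hn
    have : 0 < √Real.pi := by positivity
    linarith
  have hsm := hs m hm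
  have hsl := hs l hl
  unfold binomialWeight binomialEntropy
  rw [neg_add, Real.exp_add, exp_neg_nat_mul_log (by positivity),
    exp_neg_nat_mul_log (by positivity),
    Nat.cast_choose ℝ (Nat.le_add_right m l), Nat.add_sub_cancel_left,
    factorial_eq_stirlingSeq_mul hm, factorial_eq_stirlingSeq_mul hl,
    factorial_eq_stirlingSeq_mul (by omega : m + l ≠ 0)]
  have hsq : √(((m : ℝ) + l) / (2 * m * l)) = √(2 * ((m : ℝ) + l)) / (√(2 * m) * √(2 * l)) := by
    rw [← Real.sqrt_mul (by positivity), ← Real.sqrt_div (by positivity)]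
    congr 1
    field_simp
  have hm2 : √(2 * (m : ℝ)) ≠ 0 := by positivity
  have hl2 : √(2 * (l : ℝ)) ≠ 0 := by positivity
  have he := (Real.exp_pos 1).ne'
  rw [hsq]
  push_cast
  rw [inv_div, inv_div, pow_add]
  simp only [div_pow, mul_pow]
  field_simp

theorem abs_one_add_mul_log_sub_le {t : ℝ} (ht : |t| ≤ 1 / 2) :
    |(1 + t) * Real.log (1 + t) - t - t ^ 2 / 2| ≤ 4 * |t| ^ 3 := by
  have h := Real.abs_log_sub_add_sum_range_le (x := -t) (by rw [abs_neg]; linarith) 2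
  simp only [Finset.sum_range_succ, Finset.sum_range_zero, sub_neg_eq_add, abs_neg] at h
  have h2 : |t| ^ (2 + 1) / (1 - |t|) ≤ 2 * |t| ^ 3 := by
    rw [div_le_iff₀ (by linarith)]
    have : 0 ≤ |t| ^ 3 := by positivity
    norm_num
    nlinarith
  set R := Real.log (1 + t) - t + t ^ 2 / 2 with hR
  have hR' : |R| ≤ 2 * |t| ^ 3 := by
    refine le_trans (le_of_eq ?_) (h.trans h2)
    rw [hR]; congr 1; push_cast; ring
  have e : (1 + t) * Real.log (1 + t) - t - t ^ 2 / 2 = (1 + t) * R - t ^ 3 / 2 := by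
    rw [hR]; ring
  rw [e]
  have h3 : |(1 + t) * R| ≤ (3 / 2) * (2 * |t| ^ 3) := by
    rw [abs_mul]
    refine mul_le_mul ?_ hR' (abs_nonneg _) (by norm_num)
    rw [abs_le] at ht ⊢
    constructor <;> linarith
  have h4 : |t ^ 3 / 2| = |t| ^ 3 / 2 := by rw [abs_div, abs_pow]; norm_num
  have := abs_sub ((1 + t) * R) (t ^ 3 / 2)
  have : 0 ≤ |t| ^ 3 := by positivity
  linarith

/-- Each summand is expanded about its mean, `Np` or `N(1-p)`. The linear terms `h` and `-h` cancel,
and the quadratic ones combine through `1/(Np) + 1/(N(1-p)) = 1/v`. -/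
theorem abs_binomialEntropy_sub_le {m l : ℕ} {p v h : ℝ} (h0 : 0 < p)
    (h1 : p < 1) (hv : v = (m + l) * p * (1 - p)) (hh : h = m - (m + l) * p)
    (hsmall : |h| ≤ v / 2) (hv0 : 0 < v) :
    |binomialEntropy m l p - h ^ 2 / (2 * v)| ≤ 8 * |h| ^ 3 / v ^ 2 := by
  have hq : 0 < 1 - p := by linarith
  set N : ℝ := (m : ℝ) + l with hN
  have hNpos : 0 < N := by
    by_contra hcon
    have : N * p * (1 - p) ≤ 0 := by
      have : N ≤ 0 := not_lt.mp hcon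
      have := mul_nonneg h0.le hq.le
      nlinarith
    linarith
  -- Here `a` is either mean; both are at least `v`, so one cubic error bound serves for both.
  have key : ∀ a : ℝ, 0 < a → v ≤ a → ∀ g : ℝ, |g| = |h| →
      |(a + g) * Real.log ((a + g) / a) - g - g ^ 2 / (2 * a)| ≤ 4 * |h| ^ 3 / v ^ 2 := by
    intro a ha hva g hg
    have hga : |g / a| ≤ 1 / 2 := by
      rw [abs_div, abs_of_pos ha, div_le_iff₀ ha, hg]; linarith
    have h2 := abs_one_add_mul_log_sub_le hga
    have e : (a + g) * Real.log ((a + g) / a) - g - g ^ 2 / (2 * a) =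
        a * ((1 + g / a) * Real.log (1 + g / a) - g / a - (g / a) ^ 2 / 2) := by
      rw [show (a + g) / a = 1 + g / a by field_simp]
      field_simp
    rw [e, abs_mul, abs_of_pos ha]
    calc a * _ ≤ a * (4 * |g / a| ^ 3) := by gcongr
      _ = 4 * |h| ^ 3 / a ^ 2 := by
        rw [abs_div, abs_of_pos ha, hg]; field_simp
      _ ≤ _ := by gcongr
  have k1 := key (N * p) (by positivity) (by rw [hv]; nlinarith [mul_pos hNpos h0]) h rfl
  have k2 := key (N * (1 - p)) (by positivity) (by rw [hv]; nlinarith [mul_pos hNpos hq]) (-h)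
    (abs_neg h)
  have e1 : N * p + h = m := by rw [hh]; ring
  have e2 : N * (1 - p) + -h = l := by rw [hh, hN]; ring
  rw [e1] at k1
  rw [e2] at k2
  have e : binomialEntropy m l p - h ^ 2 / (2 * v) =
      (m * Real.log (m / (N * p)) - h - h ^ 2 / (2 * (N * p))) +
      (l * Real.log (l / (N * (1 - p))) - -h - (-h) ^ 2 / (2 * (N * (1 - p)))) := by
    unfold binomialEntropy
    rw [hv, ← hN]
    generalize Real.log (m / (N * p)) = x
    generalize Real.log (l / (N * (1 - p))) = y
    field_simp
    ring
  rw [e]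
  refine (abs_add_le _ _).trans ?_
  rw [show 8 * |h| ^ 3 / v ^ 2 = 4 * |h| ^ 3 / v ^ 2 + 4 * |h| ^ 3 / v ^ 2 by ring]
  exact add_le_add k1 k2

section LocalLimit

variable {ι : Type*} {l : Filter ι} {N m : ι → ℕ} {p : ι → ℝ}

theorem tendsto_zero_of_tendsto_pow_zero {f : ι → ℝ} (hf : ∀ᶠ i in l, 0 ≤ f i) {r : ℕ}
    (h : Tendsto (fun i => f i ^ r) l (𝓝 0)) : Tendsto f l (𝓝 0) := by
  rw [Metric.tendsto_nhds] at h ⊢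
  intro ε hε
  filter_upwards [h (ε ^ r) (by positivity), hf] with i hi hfi
  rw [Real.dist_0_eq_abs] at hi ⊢
  rw [abs_pow] at hi
  exact lt_of_pow_lt_pow_left₀ r hε.le hi

theorem tendsto_abs_div_of_cube {v h : ι → ℝ} (hv : Tendsto v l atTop)
    (hh : Tendsto (fun i => |h i| ^ 3 / v i ^ 2) l (𝓝 0)) :
    Tendsto (fun i => |h i| / v i) l (𝓝 0) := by
  refine tendsto_zero_of_tendsto_pow_zero (r := 3) ?_ ?_
  · filter_upwards [hv.eventually_gt_atTop 0] with i hi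
    positivity
  · have := hh.mul (tendsto_inv_atTop_zero.comp hv)
    rw [mul_zero] at this
    refine this.congr' ?_
    filter_upwards [hv.eventually_gt_atTop 0] with i hi
    simp only [Function.comp]
    field_simp

theorem tendsto_div_of_tendsto_abs_sub_div {v a x : ι → ℝ}
    (hva : ∀ᶠ i in l, 0 < v i ∧ v i ≤ a i)
    (h : Tendsto (fun i => |x i - a i| / v i) l (𝓝 0)) :
    Tendsto (fun i => x i / a i) l (𝓝 1) := by
  rw [tendsto_iff_dist_tendsto_zero]
  refine squeeze_zero' (Eventually.of_forall fun _ => dist_nonneg) ?_ h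
  filter_upwards [hva] with i hi
  have : 0 < a i := hi.1.trans_le hi.2
  rw [Real.dist_eq, div_sub_one this.ne', abs_div, abs_of_pos this]
  gcongr
  · exact hi.1
  · exact hi.2

theorem tendsto_natCast_of_div_tendsto_one {a : ι → ℝ} (ha : Tendsto a l atTop)
    (h : Tendsto (fun i => (m i : ℝ) / a i) l (𝓝 1)) : Tendsto m l atTop := by
  rw [← tendsto_natCast_atTop_iff (R := ℝ)]
  refine (ha.atTop_mul_pos one_pos h).congr' ?_
  filter_upwards [ha.eventually_gt_atTop 0] with i hi
  field_simp

/-- The condition `|h|³/v² → 0` is exactly what makes the cubic error of the entropy expansion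
vanish; it also forces `h = o(v)`, so successes and failures are asymptotic to their means. -/
theorem binomial_local_limit (hp : ∀ᶠ i in l, 0 < p i ∧ p i < 1)
    (hv : Tendsto (fun i => N i * p i * (1 - p i)) l atTop)
    (hh : Tendsto (fun i => |m i - N i * p i| ^ 3 / (N i * p i * (1 - p i)) ^ 2) l (𝓝 0)) :
    Tendsto (fun i => binomialWeight (N i) (p i) (m i) * √(2 * Real.pi * (N i * p i * (1 - p i))) *
      Real.exp ((m i - N i * p i) ^ 2 / (2 * (N i * p i * (1 - p i))))) l (𝓝 1) := by
  have hdiv := tendsto_abs_div_of_cube hv hh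
  set v : ι → ℝ := fun i => N i * p i * (1 - p i) with hvdef
  have hv0 := hv.eventually_gt_atTop 0
  have hvp : ∀ᶠ i in l, 0 < v i ∧ v i ≤ N i * p i := by
    filter_upwards [hp, hv0] with i hi hvi
    refine ⟨hvi, ?_⟩
    have : 0 ≤ N i * p i := mul_nonneg (Nat.cast_nonneg _) hi.1.le
    simp only [hvdef]
    nlinarith [hi.1]
  have hvq : ∀ᶠ i in l, 0 < v i ∧ v i ≤ N i * (1 - p i) := by
    filter_upwards [hp, hv0] with i hi hvi
    refine ⟨hvi, ?_⟩
    have : 0 ≤ N i * (1 - p i) := mul_nonneg (Nat.cast_nonneg _) (by linarith [hi.2])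
    simp only [hvdef]
    nlinarith [hi.1]
  have hle : ∀ᶠ i in l, m i ≤ N i := by
    filter_upwards [hvq, (tendsto_order.1 hdiv).2 1 one_pos] with i hi h1
    rw [div_lt_one hi.1] at h1
    have := (le_abs_self _).trans (h1.le.trans hi.2)
    have : (m i : ℝ) ≤ N i := by linarith
    exact_mod_cast this
  have hNp : Tendsto (fun i => N i * p i) l atTop := tendsto_atTop_mono' l (hvp.mono fun _ h => h.2) hv
  have hNq : Tendsto (fun i => N i * (1 - p i)) l atTop :=
    tendsto_atTop_mono' l (hvq.mono fun _ h => h.2) hv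
  have r1 : Tendsto (fun i => (m i : ℝ) / (N i * p i)) l (𝓝 1) :=
    tendsto_div_of_tendsto_abs_sub_div hvp hdiv
  have r2 : Tendsto (fun i => ((N i - m i : ℕ) : ℝ) / (N i * (1 - p i))) l (𝓝 1) := by
    refine tendsto_div_of_tendsto_abs_sub_div hvq (hdiv.congr' ?_)
    filter_upwards [hle] with i hi
    rw [Nat.cast_sub hi, abs_sub_comm]
    congr 2
    ring
  have hm := tendsto_natCast_of_div_tendsto_one hNp r1
  have hl := tendsto_natCast_of_div_tendsto_one hNq r2
  have hN : Tendsto N l atTop := tendsto_atTop_mono' l hle hm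
  have hS := Stirling.tendsto_stirlingSeq_sqrt_pi
  have hpi : √Real.pi ≠ 0 := by positivity
  have t1 := (hS.comp hN).div ((hS.comp hm).mul (hS.comp hl)) (mul_ne_zero hpi hpi)
  -- The square-root factor of the Stirling form times `√(2πv)` equals `√(π · (Np/m) ·
  -- (N(1-p)/(N-m)))`. Its limit `√π` cancels the `1/√π` from `t1`.
  have t2 := (Real.continuous_sqrt.tendsto _).comp
    (((r1.inv₀ one_ne_zero).mul (r2.inv₀ one_ne_zero)).const_mul Real.pi)
  have t3 : Tendsto (fun i => (m i - N i * p i) ^ 2 / (2 * v i) -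
      binomialEntropy (m i) (N i - m i) (p i)) l (𝓝 0) := by
    have h8 := hh.const_mul 8
    rw [mul_zero] at h8
    refine squeeze_zero_norm' ?_ h8
    filter_upwards [hp, hv0, hle, (tendsto_order.1 hdiv).2 (1 / 2) (by norm_num)] with i hi hvi hli hd
    rw [div_lt_iff₀ hvi] at hd
    have e : (m i : ℝ) + ((N i - m i : ℕ) : ℝ) = N i := by rw [Nat.cast_sub hli]; ring
    have := abs_binomialEntropy_sub_le (m := m i) (l := N i - m i) (v := v i)
      (h := m i - N i * p i) hi.1 hi.2 (by rw [e]) (by rw [e]) (by linarith) hvi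
    rw [Real.norm_eq_abs, abs_sub_comm]
    refine this.trans (le_of_eq ?_)
    ring
  have t4 := (Real.continuous_exp.tendsto _).comp t3
  have t := (t1.mul t2).mul t4
  have hone : √Real.pi / (√Real.pi * √Real.pi) * √(Real.pi * (1⁻¹ * 1⁻¹)) * Real.exp 0 = 1 := by
    rw [Real.exp_zero, inv_one, mul_one, mul_one, mul_one]
    field_simp
  rw [hone] at t
  refine t.congr' ?_
  filter_upwards [hp, hv0, hle, hm.eventually_gt_atTop 0, hl.eventually_gt_atTop 0]
    with i hi hvi hli hmi hlmi
  have e : (m i : ℝ) + ((N i - m i : ℕ) : ℝ) = N i := by rw [Nat.cast_sub hli]; ring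
  have e' := Nat.add_sub_cancel' hli
  have hb := binomialWeight_eq_stirling hmi.ne' hlmi.ne' hi.1 hi.2
  rw [e', e] at hb
  simp only [Function.comp, Pi.div_apply]
  rw [hb, sub_eq_add_neg _ (binomialEntropy _ _ _), Real.exp_add]
  have hq : 0 < 1 - p i := by linarith [hi.2]
  have hNi : (0 : ℝ) < N i := by
    have : (0 : ℝ) < m i := by exact_mod_cast hmi
    have : (m i : ℝ) ≤ N i := by exact_mod_cast hli
    linarith
  have hpi := hi.1
  have hmi' : (0 : ℝ) < m i := by exact_mod_cast hmi
  have hli' : (0 : ℝ) < (N i - m i : ℕ) := by exact_mod_cast hlmi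
  have hsq : √(Real.pi * (((m i : ℝ) / (N i * p i))⁻¹ *
      (((N i - m i : ℕ) : ℝ) / (N i * (1 - p i)))⁻¹)) =
      √(N i / (2 * m i * (N i - m i : ℕ))) * √(2 * Real.pi * v i) := by
    rw [← Real.sqrt_mul (by positivity)]
    congr 1
    simp only [hvdef]
    field_simp
  rw [hsq]
  ring

end LocalLimit

/-! ### Upper tail of the binomial law -/

/-- The probability that a binomial `(N, p)` variable is at least `m`. -/
noncomputable def binomialTail (N : ℕ) (p : ℝ) (m : ℕ) : ℝ :=
  ∑ j ∈ Finset.Icc m N, binomialWeight N p j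

/-- The ratio of the binomial weights at `j + 1` and `j`. -/
noncomputable def binomialRatio (N : ℕ) (p : ℝ) (j : ℕ) : ℝ :=
  (N - j) * p / ((j + 1) * (1 - p))

theorem binomialWeight_eq_zero {N : ℕ} {p : ℝ} {j : ℕ} (h : N < j) : binomialWeight N p j = 0 := by
  simp [binomialWeight, Nat.choose_eq_zero_of_lt h]

theorem binomialWeight_succ {N : ℕ} {p : ℝ} (h1 : p < 1) (j : ℕ) :
    binomialWeight N p (j + 1) = binomialWeight N p j * binomialRatio N p j := by
  rcases lt_or_ge j N with h | h
  · have hq : 0 < 1 - p := by linarith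
    have e := Nat.choose_succ_right_eq N j
    have e' : (N.choose (j + 1) : ℝ) * (j + 1) = N.choose j * (N - j) := by
      rw [← Nat.cast_sub h.le]; exact_mod_cast e
    have e2 : N - j = (N - (j + 1)) + 1 := by omega
    unfold binomialWeight binomialRatio
    rw [e2, pow_succ, pow_succ]
    have hj : (j : ℝ) + 1 ≠ 0 := by positivity
    have : (N.choose (j + 1) : ℝ) = N.choose j * (N - j) / (j + 1) := by field_simp; exact e'
    rw [this]
    field_simp
  · rcases h.eq_or_lt with h | h
    · subst h
      rw [binomialWeight_eq_zero (Nat.lt_succ_self _)]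
      simp [binomialRatio]
    · rw [binomialWeight_eq_zero h, binomialWeight_eq_zero (h.trans (Nat.lt_succ_self _)), zero_mul]

theorem binomialWeight_pos {N : ℕ} {p : ℝ} (h0 : 0 < p) (h1 : p < 1) {j : ℕ} (hj : j ≤ N) :
    0 < binomialWeight N p j := by
  have : 0 < 1 - p := by linarith
  have := Nat.choose_pos hj
  unfold binomialWeight; positivity

theorem binomialRatio_antitone {N : ℕ} {p : ℝ} (h0 : 0 < p) (h1 : p < 1) :
    Antitone (binomialRatio N p) := by
  have hq : 0 < 1 - p := by linarith
  have e : ∀ j : ℕ, binomialRatio N p j = (((N : ℝ) + 1) / (j + 1) - 1) * (p / (1 - p)) := by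
    intro j
    unfold binomialRatio
    have hj : (j : ℝ) + 1 ≠ 0 := by positivity
    field_simp
    ring
  intro a b hab
  rw [e, e]
  gcongr

theorem binomialRatio_nonneg {N : ℕ} {p : ℝ} (h0 : 0 < p) (h1 : p < 1) {j : ℕ} (hj : j ≤ N) :
    0 ≤ binomialRatio N p j := by
  have hq : 0 < 1 - p := by linarith
  have : (0 : ℝ) ≤ N - j := by rw [sub_nonneg]; exact_mod_cast hj
  unfold binomialRatio
  positivity

theorem one_sub_binomialRatio {N : ℕ} {p : ℝ} (h1 : p < 1) (j : ℕ) :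
    1 - binomialRatio N p j = (j - N * p + (1 - p)) / ((j + 1) * (1 - p)) := by
  have hq : 0 < 1 - p := by linarith
  have hj : (j : ℝ) + 1 ≠ 0 := by positivity
  unfold binomialRatio
  field_simp
  ring

/-- Successive ratios decrease, so from `m` on the weights lie below a geometric sequence with the
first ratio. -/
theorem binomialTail_le {N : ℕ} {p : ℝ} (h0 : 0 < p) (h1 : p < 1) {m : ℕ} (hm : m ≤ N)
    (hr : binomialRatio N p m < 1) :
    binomialTail N p m ≤ binomialWeight N p m / (1 - binomialRatio N p m) := by
  have hr0 := binomialRatio_nonneg h0 h1 hm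
  have hw := binomialWeight_nonneg (N := N) h0.le h1.le
  have step : ∀ i, binomialWeight N p (m + i) ≤ binomialWeight N p m * binomialRatio N p m ^ i := by
    intro i
    induction i with
    | zero => simp
    | succ i ih =>
      rw [← add_assoc, binomialWeight_succ h1, pow_succ, ← mul_assoc]
      have := binomialRatio_antitone (N := N) h0 h1 (Nat.le_add_right m i)
      calc _ ≤ binomialWeight N p (m + i) * binomialRatio N p m := by
            gcongr; exact hw _
        _ ≤ _ := by gcongr
  have e : binomialTail N p m = ∑ i ∈ Finset.range (N + 1 - m), binomialWeight N p (m + i) := by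
    rw [binomialTail, ← Finset.sum_Ico_eq_sum_range, Finset.Ico_add_one_right_eq_Icc]
  rw [e]
  calc _ ≤ ∑ i ∈ Finset.range (N + 1 - m), binomialWeight N p m * binomialRatio N p m ^ i :=
        Finset.sum_le_sum fun i _ => step i
    _ = binomialWeight N p m * ∑ i ∈ Finset.range (N + 1 - m), binomialRatio N p m ^ i := by
        rw [Finset.mul_sum]
    _ ≤ binomialWeight N p m * (1 - binomialRatio N p m)⁻¹ := by
        gcongr
        · exact hw _
        · rw [← tsum_geometric_of_lt_one hr0 hr]
          exact (summable_geometric_of_lt_one hr0 hr).sum_le_tsum _ fun _ _ => by positivity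
    _ = _ := by rw [div_eq_mul_inv]

/-- Only `M` terms are kept; over that window every ratio is at least the one at its far end. -/
theorem le_binomialTail {N : ℕ} {p : ℝ} (h0 : 0 < p) (h1 : p < 1) {m M : ℕ} (hm : m + M ≤ N)
    (hr : binomialRatio N p (m + M) < 1) :
    binomialWeight N p m * ((1 - binomialRatio N p (m + M) ^ M) / (1 - binomialRatio N p (m + M)))
      ≤ binomialTail N p m := by
  set R := binomialRatio N p (m + M) with hR
  have hr0 : 0 ≤ R := binomialRatio_nonneg h0 h1 hm
  have hw := binomialWeight_nonneg (N := N) h0.le h1.le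
  have step : ∀ i ≤ M, binomialWeight N p m * R ^ i ≤ binomialWeight N p (m + i) := by
    intro i
    induction i with
    | zero => simp
    | succ i ih =>
      intro hi
      rw [← add_assoc, binomialWeight_succ h1, pow_succ, ← mul_assoc]
      have h2 : R ≤ binomialRatio N p (m + i) :=
        binomialRatio_antitone (N := N) h0 h1 (by omega)
      have := ih (by omega)
      calc _ ≤ binomialWeight N p (m + i) * R := by gcongr
        _ ≤ _ := by gcongr; exact hw _
  have hg : (1 - R ^ M) / (1 - R) = ∑ i ∈ Finset.range M, R ^ i := by
    rw [geom_sum_eq hr.ne, ← neg_div_neg_eq, neg_sub, neg_sub]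
  have e : binomialTail N p m = ∑ i ∈ Finset.range (N + 1 - m), binomialWeight N p (m + i) := by
    rw [binomialTail, ← Finset.sum_Ico_eq_sum_range, Finset.Ico_add_one_right_eq_Icc]
  rw [hg, e, Finset.mul_sum]
  refine (Finset.sum_le_sum fun i hi => step i (Finset.mem_range.1 hi).le).trans ?_
  refine Finset.sum_le_sum_of_subset_of_nonneg ?_ fun _ _ _ => hw _
  intro i hi
  rw [Finset.mem_range] at hi ⊢
  omega

section

variable {ι : Type*} {l : Filter ι} {N m : ι → ℕ} {p : ι → ℝ}

/-- The scale `h` is decoupled from `m` so that both ends `m` and `m + M` of the window can be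
compared with the same `h`. -/
theorem tendsto_one_sub_binomialRatio_mul (hp : ∀ᶠ i in l, 0 < p i ∧ p i < 1)
    (hv : Tendsto (fun i => N i * p i * (1 - p i)) l atTop) {h : ι → ℝ} (hh : Tendsto h l atTop)
    (hm : Tendsto (fun i => (m i - N i * p i) / h i) l (𝓝 1))
    (hmv : Tendsto (fun i => |m i - N i * p i| / (N i * p i * (1 - p i))) l (𝓝 0)) :
    Tendsto (fun i => (1 - binomialRatio (N i) (p i) (m i)) *
      (N i * p i * (1 - p i) / h i)) l (𝓝 1) := by
  set v : ι → ℝ := fun i => N i * p i * (1 - p i) with hvdef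
  have hvp : ∀ᶠ i in l, 0 < v i ∧ v i ≤ N i * p i := by
    filter_upwards [hp, hv.eventually_gt_atTop 0] with i hi hvi
    refine ⟨hvi, ?_⟩
    have : 0 ≤ N i * p i := mul_nonneg (Nat.cast_nonneg _) hi.1.le
    simp only [hvdef]
    nlinarith [hi.1]
  have hNp : Tendsto (fun i => N i * p i) l atTop :=
    tendsto_atTop_mono' l (hvp.mono fun _ h => h.2) hv
  have r1 : Tendsto (fun i => (m i : ℝ) / (N i * p i)) l (𝓝 1) :=
    tendsto_div_of_tendsto_abs_sub_div hvp hmv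
  have r2 : Tendsto (fun i => (m i : ℝ) / (N i * p i) + (N i * p i)⁻¹) l (𝓝 1) := by
    simpa using r1.add (tendsto_inv_atTop_zero.comp hNp)
  have r3 : Tendsto (fun i => (1 - p i) / h i) l (𝓝 0) := by
    refine squeeze_zero' ?_ ?_ (tendsto_inv_atTop_zero.comp hh)
    · filter_upwards [hp, hh.eventually_gt_atTop 0] with i hi hhi
      exact div_nonneg (by linarith [hi.2]) hhi.le
    · filter_upwards [hp, hh.eventually_gt_atTop 0] with i hi hhi
      simp only [Function.comp]
      rw [div_eq_mul_inv]
      exact mul_le_of_le_one_left (by positivity) (by linarith [hi.1])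
  have t := (hm.add r3).mul (r2.inv₀ one_ne_zero)
  rw [add_zero, inv_one, mul_one] at t
  refine t.congr' ?_
  filter_upwards [hp, hh.eventually_gt_atTop 0, hNp.eventually_gt_atTop 0] with i hi hhi hni
  rw [one_sub_binomialRatio hi.2]
  have hq : 0 < 1 - p i := by linarith [hi.2]
  have e : (m i : ℝ) / (N i * p i) + (N i * p i)⁻¹ = (m i + 1) / (N i * p i) := by
    field_simp
  have e2 : N i * p i * (1 - p i) / h i = N i * p i * ((1 - p i) / h i) := by ring
  rw [e, inv_div, ← add_div, e2]
  have : (m i : ℝ) + 1 ≠ 0 := by positivity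
  field_simp

theorem tendsto_binomialTail_div_binomialWeight (hp : ∀ᶠ i in l, 0 < p i ∧ p i < 1)
    (hv : Tendsto (fun i => N i * p i * (1 - p i)) l atTop)
    (hy : Tendsto (fun i => (m i - N i * p i) / √(N i * p i * (1 - p i))) l atTop)
    (hmv : Tendsto (fun i => |m i - N i * p i| / (N i * p i * (1 - p i))) l (𝓝 0)) :
    Tendsto (fun i => binomialTail (N i) (p i) (m i) / binomialWeight (N i) (p i) (m i) *
      ((m i - N i * p i) / (N i * p i * (1 - p i)))) l (𝓝 1) := by
  set v : ι → ℝ := fun i => N i * p i * (1 - p i) with hvdef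
  set h : ι → ℝ := fun i => m i - N i * p i with hhdef
  have hsv : Tendsto (fun i => √(v i)) l atTop := Real.tendsto_sqrt_atTop.comp hv
  have hv0 := hv.eventually_gt_atTop 0
  have hh : Tendsto h l atTop := by
    refine (hy.atTop_mul_atTop₀ hsv).congr' ?_
    filter_upwards [hv0] with i hi
    exact div_mul_cancel₀ _ (Real.sqrt_pos.2 hi).ne'
  have hh0 := hh.eventually_gt_atTop 0
  -- The window length must be `o(h)`, so that `1 - ratio ~ h/v` at both ends, yet satisfy `M h / v
  -- → ∞`, so that the truncated geometric series loses nothing. As `h/√v → ∞`, length `√v` does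
  -- both.
  set M : ι → ℕ := fun i => ⌈√(v i)⌉₊ with hMdef
  have hM1 : ∀ i, √(v i) ≤ M i := fun i => Nat.le_ceil _
  have hM2 : ∀ᶠ i in l, (M i : ℝ) ≤ 2 * √(v i) := by
    filter_upwards [hsv.eventually_ge_atTop 1] with i hi
    have := Nat.ceil_lt_add_one (Real.sqrt_nonneg (v i))
    linarith
  have hMh : Tendsto (fun i => (M i : ℝ) / h i) l (𝓝 0) := by
    have := (tendsto_inv_atTop_zero.comp hy).const_mul 2
    rw [mul_zero] at this
    refine squeeze_zero' (hh0.mono fun i hi => by positivity) ?_ this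
    filter_upwards [hM2, hh0] with i h1 h2
    simp only [Function.comp, inv_div]
    rw [← mul_div_assoc]
    gcongr
  have hMv : Tendsto (fun i => (M i : ℝ) / v i) l (𝓝 0) := by
    have := (tendsto_inv_atTop_zero.comp hsv).const_mul 2
    rw [mul_zero] at this
    refine squeeze_zero' (hv0.mono fun i hi => by positivity) ?_ this
    filter_upwards [hM2, hv0] with i h1 h2
    simp only [Function.comp]
    rw [div_le_iff₀ h2]
    have := Real.mul_self_sqrt h2.le
    have h3 := Real.sqrt_pos.2 h2
    calc _ ≤ 2 * √(v i) := h1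
      _ = 2 * (√(v i))⁻¹ * (√(v i) * √(v i)) := by field_simp
      _ = _ := by rw [this]
  have s1 := tendsto_one_sub_binomialRatio_mul hp hv hh
    (tendsto_const_nhds.congr' (hh0.mono fun i hi => (div_self hi.ne').symm)) hmv
  have hmM : Tendsto (fun i => |((m i + M i : ℕ) : ℝ) - N i * p i| / v i) l (𝓝 0) := by
    have := hmv.add hMv
    rw [add_zero] at this
    refine squeeze_zero' (hv0.mono fun i hi => by positivity) ?_ this
    filter_upwards [hv0] with i hi
    rw [← add_div]
    gcongr
    push_cast
    rw [add_sub_right_comm]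
    refine (abs_add_le _ _).trans ?_
    rw [Nat.abs_cast]
  have s2 := tendsto_one_sub_binomialRatio_mul (m := fun i => m i + M i) hp hv hh (by
    have := hMh.const_add 1
    rw [add_zero] at this
    refine this.congr' ?_
    filter_upwards [hh0] with i hi
    push_cast
    rw [add_sub_right_comm, add_div, show (m i : ℝ) - N i * p i = h i from rfl, div_self hi.ne'])
    hmM
  have hle : ∀ᶠ i in l, m i + M i ≤ N i := by
    filter_upwards [hp, hv0, (tendsto_order.1 hmM).2 1 one_pos] with i hi hvi h1
    rw [div_lt_one hvi] at h1
    have h2 := (le_abs_self _).trans h1.le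
    have h3 : v i ≤ N i * (1 - p i) := by
      have : 0 ≤ N i * (1 - p i) := mul_nonneg (Nat.cast_nonneg _) (by linarith [hi.2])
      simp only [hvdef]
      nlinarith [hi.1]
    have : ((m i + M i : ℕ) : ℝ) ≤ N i := by linarith
    exact_mod_cast this
  have hRM : Tendsto (fun i => binomialRatio (N i) (p i) (m i + M i) ^ M i) l (𝓝 0) := by
    have e1 : Tendsto (fun i => h i / √(v i) * ((1 - binomialRatio (N i) (p i) (m i + M i)) *
      (v i / h i))) l atTop := hy.atTop_mul_pos one_pos s2
    refine squeeze_zero' ?_ ?_ (Real.tendsto_exp_neg_atTop_nhds_zero.comp e1)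
    · filter_upwards [hle, hp] with i hi hpi
      exact pow_nonneg (binomialRatio_nonneg hpi.1 hpi.2 hi) _
    · filter_upwards [hle, hp, hv0, hh0, (tendsto_order.1 s2).1 0 one_pos] with i hi hpi hvi hhi h2
      set R := binomialRatio (N i) (p i) (m i + M i) with hR
      have hR0 : 0 ≤ R := binomialRatio_nonneg hpi.1 hpi.2 hi
      have hR1 : 0 < 1 - R := pos_of_mul_pos_left h2 (by positivity)
      have := Real.sqrt_pos.2 hvi
      calc R ^ M i ≤ Real.exp (-(1 - R)) ^ M i := by
            gcongr
            have := Real.add_one_le_exp (-(1 - R))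
            linarith
        _ = Real.exp (-(M i * (1 - R))) := by rw [← Real.exp_nat_mul]; ring_nf
        _ ≤ Real.exp (-(√(v i) * (1 - R))) := by
            gcongr
            exact hM1 i
        _ = _ := by
            simp only [Function.comp]
            congr 2
            have e := Real.mul_self_sqrt hvi.le
            have : v i / √(v i) = √(v i) := by rw [div_eq_iff this.ne', e]
            calc _ = (v i / √(v i)) * (1 - R) := by rw [this]
              _ = _ := by rw [hR]; field_simp
  have lo := (hRM.const_sub 1).div s2 one_ne_zero
  have hi := s1.inv₀ one_ne_zero
  rw [sub_zero, div_one] at lo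
  rw [inv_one] at hi
  refine tendsto_of_tendsto_of_tendsto_of_le_of_le' lo hi ?_ ?_
  · filter_upwards [hle, hp, hv0, hh0, (tendsto_order.1 s2).1 0 one_pos] with i hi hpi hvi hhi h2
    have hR1 : 0 < 1 - binomialRatio (N i) (p i) (m i + M i) := pos_of_mul_pos_left h2 (by positivity)
    have hw := binomialWeight_pos hpi.1 hpi.2 ((Nat.le_add_right _ _).trans hi)
    have := le_binomialTail hpi.1 hpi.2 hi (by linarith)
    simp only [Pi.div_apply]
    calc _ = (binomialWeight (N i) (p i) (m i) * ((1 - binomialRatio (N i) (p i) (m i + M i) ^ M i) /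
        (1 - binomialRatio (N i) (p i) (m i + M i)))) / binomialWeight (N i) (p i) (m i) *
          (h i / v i) := by
          rw [show (N i * p i * (1 - p i)) = v i from rfl]
          field_simp
      _ ≤ _ := by gcongr
  · filter_upwards [hle, hp, hv0, hh0, (tendsto_order.1 s1).1 0 one_pos] with i hi hpi hvi hhi h2
    have hR1 : 0 < 1 - binomialRatio (N i) (p i) (m i) := pos_of_mul_pos_left h2 (by positivity)
    have hw := binomialWeight_pos hpi.1 hpi.2 ((Nat.le_add_right _ _).trans hi)
    have := binomialTail_le hpi.1 hpi.2 ((Nat.le_add_right _ _).trans hi) (by linarith)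
    calc _ ≤ (binomialWeight (N i) (p i) (m i) / (1 - binomialRatio (N i) (p i) (m i))) /
          binomialWeight (N i) (p i) (m i) * (h i / v i) := by gcongr
      _ = _ := by
          rw [show (N i * p i * (1 - p i)) = v i from rfl]
          field_simp

/-- Moderate deviations for the binomial law: the upper tail at distance `y` standard deviations
from the mean is asymptotic to the Gaussian tail as long as `y` tends to infinity more slowly than
the sixth root of the variance. -/
theorem binomial_moderate_deviation (hp : ∀ᶠ i in l, 0 < p i ∧ p i < 1)
    (hv : Tendsto (fun i => N i * p i * (1 - p i)) l atTop)
    (hy : Tendsto (fun i => (m i - N i * p i) / √(N i * p i * (1 - p i))) l atTop)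
    (hh : Tendsto (fun i => |m i - N i * p i| ^ 3 / (N i * p i * (1 - p i)) ^ 2) l (𝓝 0)) :
    Tendsto (fun i => binomialTail (N i) (p i) (m i) *
      ((m i - N i * p i) / √(N i * p i * (1 - p i)) * √(2 * Real.pi) *
      Real.exp (((m i - N i * p i) / √(N i * p i * (1 - p i))) ^ 2 / 2))) l (𝓝 1) := by
  have t := (tendsto_binomialTail_div_binomialWeight hp hv hy (tendsto_abs_div_of_cube hv hh)).mul
    (binomial_local_limit hp hv hh)
  rw [mul_one] at t
  refine t.congr' ?_
  filter_upwards [hp, hv.eventually_gt_atTop 0, (tendsto_order.1 (tendsto_abs_div_of_cube hv hh)).2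
    1 one_pos] with i hpi hvi h1
  have hmN : m i ≤ N i := by
    rw [div_lt_one hvi] at h1
    have h2 := (le_abs_self _).trans h1.le
    have h3 : N i * p i * (1 - p i) ≤ N i * (1 - p i) := by
      have : 0 ≤ N i * (1 - p i) := mul_nonneg (Nat.cast_nonneg _) (by linarith [hpi.2])
      nlinarith [hpi.1]
    have : (m i : ℝ) ≤ N i := by linarith
    exact_mod_cast this
  have hw := binomialWeight_pos hpi.1 hpi.2 hmN
  rw [Real.sqrt_mul (by positivity), div_pow, Real.sq_sqrt hvi.le, div_div, mul_comm _ (2 : ℝ)]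
  have hs := Real.sqrt_pos.2 hvi
  have e := Real.mul_self_sqrt hvi.le
  set v := N i * p i * (1 - p i)
  have e1 : √v / v = 1 / √v := by rw [div_eq_div_iff hvi.ne' hs.ne']; linarith
  calc _ = binomialTail (N i) (p i) (m i) * ((m i - N i * p i) * (√v / v) * √(2 * Real.pi) *
        Real.exp ((m i - N i * p i) ^ 2 / (2 * v))) := by field_simp
    _ = _ := by rw [e1]; ring

end

/-! ### The extreme value threshold -/

section

open RandomHypergraph

/-- The extreme value threshold in units of the standard deviation, as a function of `log d`. -/
noncomputable def standardThreshold (x t : ℝ) : ℝ :=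
  √(2 * t) * (1 - (Real.log t / 2 + Real.log (2 * √Real.pi) - x) / (2 * t))

theorem centring_add_scaling_mul {d N : ℕ} {p : ℝ} (h0 : 0 ≤ p) (h1 : p ≤ 1)
    (hd : 0 < Real.log d) (x : ℝ) :
    centring d N p + scaling d N p * x =
      N * p + √(N * p * (1 - p)) * standardThreshold x (Real.log d) := by
  have hq : 0 ≤ 1 - p := by linarith
  have hv : 0 ≤ N * p * (1 - p) := by positivity
  unfold centring scaling standardThreshold
  generalize Real.log d = t at *
  rw [show 2 * (N : ℝ) * p * (1 - p) * t = N * p * (1 - p) * (2 * t) by ring, Real.sqrt_mul hv,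
    Real.sqrt_div hv]
  generalize √(N * p * (1 - p)) = s
  have hu : 0 < √(2 * t) := Real.sqrt_pos.2 (by linarith)
  have e : 2 * t = √(2 * t) * √(2 * t) := (Real.mul_self_sqrt (by linarith)).symm
  have e2 : s / √(2 * t) * x = s * √(2 * t) * (x / (2 * t)) := by
    nth_rewrite 3 [e]
    field_simp
  rw [e2]
  field_simp
  ring

theorem tendsto_log_add_const_div (c : ℝ) :
    Tendsto (fun t => (Real.log t / 2 + c) / (2 * t)) atTop (𝓝 0) := by
  have h1 : Tendsto (fun t : ℝ => Real.log t / t) atTop (𝓝 0) :=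
    Real.isLittleO_log_id_atTop.tendsto_div_nhds_zero
  have h2 : Tendsto (fun t : ℝ => c * t⁻¹) atTop (𝓝 (c * 0)) :=
    tendsto_inv_atTop_zero.const_mul c
  have := (h1.const_mul (1 / 4)).add (h2.const_mul (1 / 2))
  simp only [mul_zero, add_zero] at this
  refine this.congr fun t => ?_
  ring

theorem tendsto_sq_log_add_const_div (c : ℝ) :
    Tendsto (fun t => (Real.log t / 2 + c) ^ 2 / (4 * t)) atTop (𝓝 0) := by
  have h1 : Tendsto (fun t : ℝ => Real.log t / t) atTop (𝓝 0) :=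
    Real.isLittleO_log_id_atTop.tendsto_div_nhds_zero
  have h0 : Tendsto (fun t : ℝ => Real.log t ^ 2 / t) atTop (𝓝 0) :=
    (Real.isLittleO_pow_log_id_atTop (n := 2)).tendsto_div_nhds_zero
  have h2 : Tendsto (fun t : ℝ => t⁻¹) atTop (𝓝 0) := tendsto_inv_atTop_zero
  have := ((h0.const_mul (1 / 16)).add (h1.const_mul (c / 4))).add (h2.const_mul (c ^ 2 / 4))
  simp only [mul_zero, add_zero] at this
  refine this.congr fun t => ?_
  ring

theorem tendsto_standardThreshold_div_sqrt (x : ℝ) :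
    Tendsto (fun t => standardThreshold x t / √(2 * t)) atTop (𝓝 1) := by
  have := (tendsto_log_add_const_div (Real.log (2 * √Real.pi) - x)).const_sub 1
  rw [sub_zero] at this
  refine this.congr' ?_
  filter_upwards [eventually_gt_atTop 0] with t ht
  have : 0 < √(2 * t) := Real.sqrt_pos.2 (by linarith)
  unfold standardThreshold
  rw [mul_div_cancel_left₀ _ this.ne', add_sub_assoc]

/-- With `c = log(2√π) - x`, squaring gives `t - z²/2 = log t/2 + c - (log t/2 + c)²/(4t)`, and the
last term vanishes. -/
theorem tendsto_sub_sq_standardThreshold (x : ℝ) :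
    Tendsto (fun t => t - standardThreshold x t ^ 2 / 2 -
      (Real.log t / 2 + Real.log (2 * √Real.pi))) atTop (𝓝 (-x)) := by
  have := (tendsto_sq_log_add_const_div (Real.log (2 * √Real.pi) - x)).const_sub (-x)
  rw [sub_zero] at this
  refine this.congr' ?_
  filter_upwards [eventually_gt_atTop 0] with t ht
  unfold standardThreshold
  rw [mul_pow, Real.sq_sqrt (by linarith)]
  field_simp
  ring

variable {ι : Type*} {l : Filter ι} {N d : ι → ℕ} {p : ι → ℝ}

/-- The Gaussian tail is `exp(-y²/2)/(y√(2π))` with `y ~ √(2 log d)`. The centring is designed so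
that `d` times this has logarithm `-x + o(1)`. -/
theorem tendsto_mul_binomialTail_threshold (hp : ∀ᶠ i in l, 0 < p i ∧ p i < 1)
    (hd : Tendsto d l atTop)
    (hv : Tendsto (fun i => N i * p i * (1 - p i)) l atTop)
    (hL : Tendsto (fun i => Real.log (d i) ^ 3 / (N i * p i * (1 - p i))) l (𝓝 0)) (x : ℝ) :
    Tendsto (fun i => d i * binomialTail (N i) (p i)
      (⌊centring (d i) (N i) (p i) + scaling (d i) (N i) (p i) * x⌋₊ + 1)) l
        (𝓝 (Real.exp (-x))) := by
  set v : ι → ℝ := fun i => N i * p i * (1 - p i) with hvdef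
  set t : ι → ℝ := fun i => Real.log (d i) with htdef
  have ht : Tendsto t l atTop := Real.tendsto_log_atTop.comp (tendsto_natCast_atTop_atTop.comp hd)
  have ht0 := ht.eventually_ge_atTop 1
  have hv0 := hv.eventually_gt_atTop 0
  have hsv : Tendsto (fun i => √(v i)) l atTop := Real.tendsto_sqrt_atTop.comp hv
  set u : ι → ℝ := fun i => √(2 * t i) with hudef
  have hu : Tendsto u l atTop :=
    Real.tendsto_sqrt_atTop.comp (ht.const_mul_atTop two_pos)
  have hu0 := hu.eventually_gt_atTop 0
  set z : ι → ℝ := fun i => standardThreshold x (t i) with hzdef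
  have hzu : Tendsto (fun i => z i / u i) l (𝓝 1) := (tendsto_standardThreshold_div_sqrt x).comp ht
  have hz : Tendsto z l atTop := by
    refine (hu.atTop_mul_pos one_pos hzu).congr' ?_
    filter_upwards [hu0] with i hi
    field_simp
  -- A strict exceedance of `c ≥ 0` by an integer means being at least `⌊c⌋₊ + 1`; the rounding
  -- costs at most `1/√v` standard deviations.
  set m : ι → ℕ := fun i =>
    ⌊centring (d i) (N i) (p i) + scaling (d i) (N i) (p i) * x⌋₊ + 1 with hmdef
  set y : ι → ℝ := fun i => (m i - N i * p i) / √(v i) with hydef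
  have hyz : ∀ᶠ i in l, 0 ≤ y i - z i ∧ y i - z i ≤ (√(v i))⁻¹ := by
    filter_upwards [hp, ht0, hv0, hz.eventually_ge_atTop 0] with i hpi hti hvi hzi
    have e := centring_add_scaling_mul (N := N i) hpi.1.le hpi.2.le
      (show 0 < Real.log (d i) from by linarith) x
    have hs := Real.sqrt_pos.2 hvi
    have hc : 0 ≤ N i * p i + √(v i) * z i :=
      add_nonneg (mul_nonneg (Nat.cast_nonneg _) hpi.1.le) (by positivity)
    have h1 := Nat.floor_le hc
    have h2 := Nat.lt_floor_add_one (N i * p i + √(v i) * z i)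
    have e3 : (m i : ℝ) = ⌊N i * p i + √(v i) * z i⌋₊ + 1 := by
      simp only [hmdef]
      push_cast
      rw [e]
    have e4 : y i - z i = (m i - (N i * p i + √(v i) * z i)) / √(v i) := by
      simp only [hydef]
      field_simp
      ring
    rw [e4, e3, inv_eq_one_div]
    refine ⟨div_nonneg (by linarith) hs.le, ?_⟩
    gcongr
    linarith
  have hu3 : Tendsto (fun i => u i ^ 3 / √(v i)) l (𝓝 0) := by
    have := (Real.continuous_sqrt.tendsto _).comp (hL.const_mul 8)
    rw [mul_zero, Real.sqrt_zero] at this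
    refine this.congr' ?_
    filter_upwards [ht0, hv0] with i hti hvi
    simp only [Function.comp, hudef]
    rw [← mul_div_assoc, Real.sqrt_div (by positivity),
      show 8 * t i ^ 3 = (2 * t i) ^ 2 * (2 * t i) by ring, Real.sqrt_mul (by positivity),
      Real.sqrt_sq (by positivity), pow_succ, Real.sq_sqrt (by positivity)]
  have hu1 : Tendsto (fun i => u i / √(v i)) l (𝓝 0) := by
    refine squeeze_zero' (hu0.mono fun i hi => by positivity) ?_ hu3
    filter_upwards [hu.eventually_ge_atTop 1] with i hi
    gcongr
    exact le_self_pow₀ hi (by norm_num)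
  have hyzu : Tendsto (fun i => (y i - z i) / u i) l (𝓝 0) := by
    refine squeeze_zero' ?_ ?_ (tendsto_inv_atTop_zero.comp hsv)
    · filter_upwards [hyz, hu0] with i h1 h2
      exact div_nonneg h1.1 h2.le
    · filter_upwards [hyz, hu.eventually_ge_atTop 1] with i h1 h2
      exact (div_le_self h1.1 h2).trans h1.2
  have hyu : Tendsto (fun i => y i / u i) l (𝓝 1) := by
    have := hyzu.add hzu
    rw [zero_add] at this
    refine this.congr fun i => ?_
    ring
  have hy : Tendsto y l atTop := by
    refine (hu.atTop_mul_pos one_pos hyu).congr' ?_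
    filter_upwards [hu0] with i hi
    field_simp
  -- Rounding is harmless in the exponent: the difference is at most `(y + z)/2 · 1/√v`, of order
  -- `√(log d / v)`.
  have hyz2 : Tendsto (fun i => y i ^ 2 / 2 - z i ^ 2 / 2) l (𝓝 0) := by
    have := ((hyu.add hzu).mul hu1).const_mul (1 / 2)
    simp only [mul_zero] at this
    refine squeeze_zero' ?_ ?_ this
    · filter_upwards [hyz, hz.eventually_ge_atTop 0] with i h1 h2
      nlinarith [h1.1]
    · filter_upwards [hyz, hz.eventually_ge_atTop 0, hy.eventually_ge_atTop 0, hu0]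
        with i h1 h2 h3 h4
      calc y i ^ 2 / 2 - z i ^ 2 / 2 = (y i + z i) / 2 * (y i - z i) := by ring
        _ ≤ (y i + z i) / 2 * (√(v i))⁻¹ := by gcongr; exact h1.2
        _ = _ := by field_simp
  have hy3 : Tendsto (fun i => |m i - N i * p i| ^ 3 / v i ^ 2) l (𝓝 0) := by
    have := (hyu.pow 3).mul hu3
    rw [mul_zero] at this
    refine this.congr' ?_
    filter_upwards [hu0, hv0, hy.eventually_ge_atTop 0] with i h1 h2 h3
    have hs := Real.sqrt_pos.2 h2
    have e : (m i : ℝ) - N i * p i = √(v i) * y i := by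
      simp only [hydef]
      field_simp
    have e2 : v i = √(v i) ^ 2 := (Real.sq_sqrt h2.le).symm
    rw [e, abs_of_nonneg (by positivity)]
    nth_rewrite 3 [e2]
    field_simp
  have key := binomial_moderate_deviation hp hv hy hy3
  have g1 := (tendsto_sub_sq_standardThreshold x).comp ht
  have g2 := (Real.continuous_exp.tendsto _).comp (g1.sub hyz2)
  have g := (key.mul g2).mul (hyu.inv₀ one_ne_zero)
  rw [inv_one, sub_zero, one_mul, mul_one] at g
  refine g.congr' ?_
  filter_upwards [ht0, hu0, hv0, hy.eventually_gt_atTop 0, hd.eventually_gt_atTop 0]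
    with i hti hui hvi hyi hdi
  have hdi' : (0 : ℝ) < d i := by exact_mod_cast hdi
  simp only [Function.comp]
  have e1 : Real.exp (t i - standardThreshold x (t i) ^ 2 / 2 -
      (Real.log (t i) / 2 + Real.log (2 * √Real.pi)) - (y i ^ 2 / 2 - z i ^ 2 / 2)) =
      d i * Real.exp (-(y i ^ 2 / 2)) / (√(t i) * (2 * √Real.pi)) := by
    have a1 : Real.exp (t i) = d i := Real.exp_log hdi'
    have a2 : Real.exp (Real.log (t i) / 2) = √(t i) := by
      rw [Real.sqrt_eq_rpow, Real.rpow_def_of_pos (by linarith)]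
      congr 1; ring
    have a3 : Real.exp (Real.log (2 * √Real.pi)) = 2 * √Real.pi := Real.exp_log (by positivity)
    rw [← a1, ← a2, ← a3, ← Real.exp_add, ← Real.exp_add, ← Real.exp_sub, a3]
    congr 1
    simp only [hzdef]
    ring
  -- This is the origin of `log log d` and `log(2√π)` in the centring: they absorb the Gaussian
  -- prefactor.
  have e2 : u i * √(2 * Real.pi) = √(t i) * (2 * √Real.pi) := by
    simp only [hudef]
    rw [Real.sqrt_mul two_pos.le, Real.sqrt_mul two_pos.le]
    have := Real.mul_self_sqrt (two_pos (α := ℝ)).le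
    linear_combination √(t i) * √Real.pi * this
  rw [e1, ← e2, inv_div, Real.exp_neg]
  have : 0 < √(2 * Real.pi) := by positivity
  change binomialTail (N i) (p i) (m i) * (y i * √(2 * Real.pi) * Real.exp (y i ^ 2 / 2)) * _ * _ = _
  field_simp
  rfl

end

/-! ### Counts in a random set -/

section Bernoulli

variable {α : Type*} [Fintype α] {u : Set α} {p : I}

/-- The number of elements of `A` that belong to `H`. -/
noncomputable def hitCount (A : Finset α) (H : Set α) : ℕ := (H ∩ A).ncard

theorem hitCount_union [DecidableEq α] {A B : Finset α} (h : Disjoint A B) (H : Set α) :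
    hitCount (A ∪ B) H = hitCount A H + hitCount B H := by
  unfold hitCount
  rw [Finset.coe_union, Set.inter_union_distrib_left, Set.ncard_union_eq]
  exact (Finset.disjoint_coe.2 h).mono Set.inter_subset_right Set.inter_subset_right

/-- Intersecting with `A` acts coordinatewise on the product measure and turns each coordinate
outside `A` into a point mass at `False`. -/
theorem map_inter_setBernoulli (A : Set α) :
    (setBernoulli u p).map (· ∩ A) = setBernoulli (u ∩ A) p := by
  have hm : Measurable fun q : α → Prop => ({i | q i} : Set α) :=
    MeasurableEquiv.setOfPred.measurable
  rw [setBernoulli_eq_map, setBernoulli_eq_map, Measure.map_map .of_discrete hm]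
  have e : ((fun H : Set α => H ∩ A) ∘ fun q : α → Prop => {i | q i}) =
      (fun q : α → Prop => {i | q i}) ∘ (fun q i => q i ∧ i ∈ A) := by
    ext q i
    simp
  rw [e, ← Measure.map_map hm (by fun_prop),
    Measure.infinitePi_map_pi (f := fun i (b : Prop) => b ∧ i ∈ A) _ (fun i => .of_discrete)]
  congr 2
  ext i
  rw [Measure.map_add _ _ .of_discrete, Measure.map_smul, Measure.map_smul,
    Measure.map_dirac' .of_discrete, Measure.map_dirac' .of_discrete]
  simp

theorem map_hitCount_setBernoulli {A : Finset α} (hA : (A : Set α) ⊆ u) :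
    (setBernoulli u p).map (hitCount A) = binomial A.card p := by
  have e : hitCount A = Set.ncard ∘ (· ∩ (A : Set α)) := rfl
  rw [e, ← Measure.map_map .of_discrete .of_discrete, map_inter_setBernoulli,
    Set.inter_eq_right.2 hA]
  refine Measure.ext_of_singleton fun k => ?_
  rw [map_ncard_setBernoulli_singleton A.finite_toSet, binomial_singleton, Set.ncard_coe_finset]

theorem setBernoulli_real_hitCount {A : Finset α} (hA : (A : Set α) ⊆ u) (T : Set ℕ) :
    (setBernoulli u p).real {H | hitCount A H ∈ T} = (binomial A.card p).real T := by
  rw [← map_hitCount_setBernoulli hA, map_measureReal_apply .of_discrete .of_discrete]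
  rfl

theorem iIndepFun_mem_setBernoulli :
    iIndepFun (fun (i : α) (H : Set α) => i ∈ H) (setBernoulli u p) := by
  rw [iIndepFun_iff_map_fun_eq_infinitePi_map fun i => .of_discrete]
  have e : (fun (H : Set α) (i : α) => i ∈ H) ∘ (fun q : α → Prop => {i | q i}) = id := rfl
  have hm : Measurable fun q : α → Prop => ({i | q i} : Set α) :=
    MeasurableEquiv.setOfPred.measurable
  rw [setBernoulli_eq_map, Measure.map_map .of_discrete hm, e, Measure.map_id]
  congr 1
  ext1 i
  rw [Measure.map_map .of_discrete hm]
  exact (Measure.infinitePi_map_eval (fun i => unitInterval.toNNReal p • Measure.dirac (i ∈ u) +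
    unitInterval.toNNReal (σ p) • Measure.dirac False) i).symm

theorem indepFun_inter_setBernoulli [DecidableEq α] {A B : Finset α} (h : Disjoint A B) :
    IndepFun (fun H : Set α => H ∩ A) (fun H => H ∩ B) (setBernoulli u p) := by
  have key := (iIndepFun_mem_setBernoulli (u := u) (p := p)).indepFun_finset A B h
    fun i => .of_discrete
  have e : ∀ C : Finset α, (fun H : Set α => H ∩ C) =
      (fun q : C → Prop => {i | ∃ hi : i ∈ C, q ⟨i, hi⟩}) ∘ fun H (i : C) => (i : α) ∈ H := by
    intro C
    ext H i
    simp [and_comm]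
  rw [e A, e B]
  exact key.comp .of_discrete .of_discrete

/-- Disjoint blocks of independent coordinates are independent. In the induction, the event for the
earlier blocks depends only on `H` inside their union. -/
theorem setBernoulli_real_forall_hitCount {ι : Type*} [DecidableEq α] [DecidableEq ι] {R : Finset ι}
    {B : ι → Finset α} (hB : (R : Set ι).PairwiseDisjoint B) (T : ι → Set ℕ) :
    (setBernoulli u p).real {H | ∀ i ∈ R, hitCount (B i) H ∈ T i} =
      ∏ i ∈ R, (setBernoulli u p).real {H | hitCount (B i) H ∈ T i} := by
  induction R using Finset.induction_on with
  | empty => simp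
  | insert a R ha ih =>
    rw [Finset.prod_insert ha, ← ih (hB.subset (by simp))]
    have hd : Disjoint (B a) (R.biUnion B) := by
      rw [Finset.disjoint_biUnion_right]
      intro i hi
      exact hB (by simp) (by simp [hi]) (by rintro rfl; exact ha hi)
    have key := (indepFun_inter_setBernoulli (u := u) (p := p) hd).measure_inter_preimage_eq_mul
      {F | F.ncard ∈ T a} {F | ∀ i ∈ R, hitCount (B i) F ∈ T i} .of_discrete .of_discrete
    have e : ∀ H : Set α, ∀ i ∈ R, hitCount (B i) (H ∩ (R.biUnion B : Finset α)) =
        hitCount (B i) H := by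
      intro H i hi
      unfold hitCount
      rw [Set.inter_assoc, Set.inter_eq_right.2
        (Finset.coe_subset.2 (Finset.subset_biUnion_of_mem B hi))]
    have e2 : ((fun H : Set α => H ∩ (R.biUnion B : Finset α)) ⁻¹'
        {F | ∀ i ∈ R, hitCount (B i) F ∈ T i}) = {H | ∀ i ∈ R, hitCount (B i) H ∈ T i} := by
      ext H
      simp only [Set.mem_preimage, Set.mem_ofPred_eq]
      exact forall₂_congr fun i hi => by rw [e H i hi]
    rw [e2] at key
    simp only [measureReal_def]
    refine Eq.trans ?_ ((congrArg ENNReal.toReal key).trans ENNReal.toReal_mul)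
    congr 2
    ext H
    simp [hitCount]

end Bernoulli

/-! ### Tails of the binomial law -/

theorem binomial_real_le_eq_binomialTail (N : ℕ) (p : I) (m : ℕ) :
    (binomial N p).real {j | m ≤ j} = binomialTail N p m := by
  have h : (binomial N p).real {j | m ≤ j} =
      ∫ j, ({j | m ≤ j} : Set ℕ).indicator (fun _ => (1 : ℝ)) j ∂(binomial N p) := by
    rw [integral_indicator .of_discrete]; simp
  rw [h, integral_binomial, binomialTail]
  simp only [Set.indicator_apply, Set.mem_ofPred_eq, smul_eq_mul, mul_ite, mul_one, mul_zero]
  rw [← Finset.sum_filter]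
  refine Finset.sum_congr ?_ fun _ _ => rfl
  ext j
  simp [and_comm]

/-- Apply `exp y ≤ 1 + y + y²` on `|y| ≤ 1` to the centred variable: the mean is zero and the second
moment gives the variance. -/
theorem bernoulli_mgf_le {p x : ℝ} (h0 : 0 ≤ p) (h1 : p ≤ 1) (hx : |x| ≤ 1) :
    (p * Real.exp x + (1 - p)) * Real.exp (-(x * p)) ≤ Real.exp (x ^ 2 * p * (1 - p)) := by
  have hq : 0 ≤ 1 - p := by linarith
  have key : ∀ y : ℝ, |y| ≤ 1 → Real.exp y ≤ 1 + y + y ^ 2 := fun y hy => by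
    have := le_of_abs_le (Real.abs_exp_sub_one_sub_id_le hy)
    linarith
  have k1 := key (x * (1 - p)) (by
    rw [abs_mul, abs_of_nonneg hq]; exact mul_le_one₀ hx hq (by linarith))
  have k2 := key (-(x * p)) (by
    rw [abs_neg, abs_mul, abs_of_nonneg h0]; exact mul_le_one₀ hx h0 h1)
  calc _ = p * Real.exp (x * (1 - p)) + (1 - p) * Real.exp (-(x * p)) := by
        rw [add_mul, mul_assoc, ← Real.exp_add]
        ring_nf
    _ ≤ p * (1 + x * (1 - p) + (x * (1 - p)) ^ 2) +
        (1 - p) * (1 + -(x * p) + (-(x * p)) ^ 2) := by gcongr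
    _ = x ^ 2 * p * (1 - p) + 1 := by ring
    _ ≤ _ := Real.add_one_le_exp _

theorem binomial_mgf_le (N : ℕ) (p : I) {x : ℝ} (hx : |x| ≤ 1) :
    mgf (fun j : ℕ => (j : ℝ) - N * p) (binomial N p) x ≤
      Real.exp (x ^ 2 * (N * p * (1 - p))) := by
  have e : mgf (fun j : ℕ => (j : ℝ) - N * p) (binomial N p) x =
      ((p * Real.exp x + (1 - p)) * Real.exp (-(x * p))) ^ N := by
    rw [mgf, integral_binomial, mul_pow, add_pow, Finset.sum_mul, ← Nat.range_succ_eq_Iic]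
    refine Finset.sum_congr rfl fun k hk => ?_
    rw [mul_sub, sub_eq_add_neg (x * (k : ℝ)), Real.exp_add, mul_comm x (k : ℝ), Real.exp_nat_mul, smul_eq_mul,
      ← Real.exp_nat_mul (-(x * p)), mul_pow, show -(x * (N * (p : ℝ))) = N * -(x * p) by ring]
    ring
  rw [e, show x ^ 2 * (N * (p : ℝ) * (1 - p)) = N * (x ^ 2 * p * (1 - p)) by ring,
    Real.exp_nat_mul]
  have hq : (0 : ℝ) ≤ 1 - p := sub_nonneg.2 p.2.2
  have := p.2.1
  gcongr
  exact bernoulli_mgf_le p.2.1 p.2.2 hx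

/-- Two-sided Chernoff bound, with the parameter `x` left free for the overlap estimate. -/
theorem binomial_real_abs_sub_le (N : ℕ) (p : I) {x t : ℝ} (hx0 : 0 ≤ x) (hx1 : x ≤ 1) :
    (binomial N p).real {j | t ≤ |(j : ℝ) - N * p|} ≤
      2 * Real.exp (-(x * t) + x ^ 2 * (N * p * (1 - p))) := by
  have i1 : ∀ y : ℝ, Integrable (fun j : ℕ => Real.exp (y * ((j : ℝ) - N * p))) (binomial N p) :=
    fun y => integrable_binomial _
  have u1 := measure_ge_le_exp_mul_mgf (μ := binomial N p) (X := fun j : ℕ => (j : ℝ) - N * p)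
    t hx0 (i1 x)
  have u2 := measure_le_le_exp_mul_mgf (μ := binomial N p) (X := fun j : ℕ => (j : ℝ) - N * p)
    (-t) (neg_nonpos.2 hx0) (i1 (-x))
  have m1 := binomial_mgf_le N p (x := x) (by rwa [abs_of_nonneg hx0])
  have m2 := binomial_mgf_le N p (x := -x) (by rwa [abs_neg, abs_of_nonneg hx0])
  rw [neg_sq] at m2
  have hsub : {j : ℕ | t ≤ |(j : ℝ) - N * p|} ⊆
      {j : ℕ | t ≤ (j : ℝ) - N * p} ∪ {j : ℕ | (j : ℝ) - N * p ≤ -t} := by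
    intro j hj
    rcases le_abs.1 (show t ≤ |(j : ℝ) - N * p| from hj) with h | h
    · exact Or.inl h
    · exact Or.inr (show (j : ℝ) - N * p ≤ -t by linarith)
  calc _ ≤ _ := measureReal_mono hsub
    _ ≤ _ := measureReal_union_le _ _
    _ ≤ Real.exp (-x * t) * Real.exp (x ^ 2 * (N * p * (1 - p))) +
        Real.exp (-x * t) * Real.exp (x ^ 2 * (N * p * (1 - p))) := by
        refine add_le_add (u1.trans ?_) (u2.trans ?_)
        · gcongr
        · rw [show - -x * -t = -x * t by ring]
          gcongr
    _ = _ := by rw [← Real.exp_add, neg_mul]; ring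

/-! ### Joint tails of weakly overlapping counts -/

theorem pairwiseDisjoint_sdiff_biUnion_erase {α ι : Type*} [DecidableEq α] [DecidableEq ι] (A : ι → Finset α) (R : Finset ι) :
    (R : Set ι).PairwiseDisjoint fun i => A i \ (R.erase i).biUnion A := by
  intro i hi j hj hij
  rw [Function.onFun, Finset.disjoint_left]
  intro e he1 he2
  rw [Finset.mem_sdiff] at he1 he2
  exact he1.2 (Finset.mem_biUnion.2 ⟨j, Finset.mem_erase.2 ⟨hij.symm, hj⟩, he2.1⟩)

theorem measureReal_le_add_of_subset {ι Ω : Type*} [MeasurableSpace Ω] {μ : Measure Ω}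
    [IsFiniteMeasure μ] {E F : Set Ω} {G : ι → Set Ω} {R : Finset ι} {δ : ℝ}
    (h : E ⊆ F ∪ ⋃ i ∈ R, G i) (hG : ∀ i ∈ R, μ.real (G i) ≤ δ) :
    μ.real E ≤ μ.real F + R.card * δ := by
  calc _ ≤ μ.real (F ∪ ⋃ i ∈ R, G i) := measureReal_mono h
    _ ≤ μ.real F + μ.real (⋃ i ∈ R, G i) := measureReal_union_le _ _
    _ ≤ μ.real F + ∑ i ∈ R, μ.real (G i) := by
        gcongr; exact measureReal_biUnion_finset_le _ _
    _ ≤ μ.real F + R.card * δ := by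
        gcongr
        rw [← nsmul_eq_mul]
        exact Finset.sum_le_card_nsmul _ _ _ hG

section Joint

variable {α ι : Type*} [Fintype α] [DecidableEq α] [DecidableEq ι] {u : Set α} {p : I}

theorem hitCount_eq_add {A C : Finset α} (H : Set α) :
    hitCount A H = hitCount (A \ C) H + hitCount (A ∩ C) H := by
  rw [← hitCount_union (Finset.disjoint_sdiff_inter A C), Finset.sdiff_union_inter]

variable {A : ι → Finset α} {R : Finset ι} {c t δ : ℝ}

/-- Unless an overlap count deviates by `t`, dropping the overlaps leaves independent private counts
above a threshold lowered by the overlap mean and `t`. Restoring the overlap in each factor costs a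
second `t`, hence `2 * t` and the two kinds of `δ` term. -/
theorem joint_tail_le
    (hδ : ∀ i ∈ R, (setBernoulli u p).real {H | t ≤ |(hitCount (A i ∩ (R.erase i).biUnion A) H : ℝ) -
      (A i ∩ (R.erase i).biUnion A).card * p|} ≤ δ) :
    (setBernoulli u p).real {H | ∀ i ∈ R, c < hitCount (A i) H} ≤
      ∏ i ∈ R, ((setBernoulli u p).real {H | c - 2 * t < hitCount (A i) H} + δ) + R.card * δ := by
  set C : ι → Finset α := fun i => (R.erase i).biUnion A with hC
  have h1 := setBernoulli_real_forall_hitCount (u := u) (p := p)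
    (pairwiseDisjoint_sdiff_biUnion_erase A R)
    (fun i => {j : ℕ | c - (A i ∩ C i).card * p - t < j})
  have h2 : (setBernoulli u p).real {H | ∀ i ∈ R, c < hitCount (A i) H} ≤
      (setBernoulli u p).real {H | ∀ i ∈ R, hitCount (A i \ C i) H ∈
        {j : ℕ | c - (A i ∩ C i).card * p - t < j}} + R.card * δ := by
    refine measureReal_le_add_of_subset ?_ hδ
    intro H hH
    by_cases hbad : ∃ i ∈ R, t ≤ |(hitCount (A i ∩ C i) H : ℝ) - (A i ∩ C i).card * p|
    · obtain ⟨i, hi, hb⟩ := hbad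
      exact Or.inr (Set.mem_biUnion hi hb)
    · push Not at hbad
      refine Or.inl fun i hi => ?_
      have h3 : c < hitCount (A i) H := hH i hi
      have h4 := (abs_lt.1 (hbad i hi)).2
      rw [hitCount_eq_add (C := C i)] at h3
      push_cast at h3
      change c - (A i ∩ C i).card * p - t < _
      linarith
  rw [h1] at h2
  refine h2.trans ?_
  gcongr with i hi
  have h5 := measureReal_le_add_of_subset (μ := setBernoulli u p) (R := {i})
    (E := {H | hitCount (A i \ C i) H ∈ {j : ℕ | c - (A i ∩ C i).card * p - t < j}})
    (F := {H | c - 2 * t < hitCount (A i) H})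
    (G := fun i => {H | t ≤ |(hitCount (A i ∩ C i) H : ℝ) - (A i ∩ C i).card * p|}) (δ := δ)
    (fun H hH => by
      by_cases hbad : t ≤ |(hitCount (A i ∩ C i) H : ℝ) - (A i ∩ C i).card * p|
      · exact Or.inr (by simpa using hbad)
      · have h4 := (abs_lt.1 (not_le.1 hbad)).1
        have h3 : c - (A i ∩ C i).card * p - t < hitCount (A i \ C i) H := hH
        refine Or.inl ?_
        change c - 2 * t < hitCount (A i) H
        rw [hitCount_eq_add (C := C i)]
        push_cast
        linarith)
    (fun j hj => by rw [Finset.mem_singleton] at hj; subst hj; exact hδ j hi)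
  simpa using h5

/-- The mirror argument with the threshold raised; `hnn` keeps the factors nonnegative, as comparing
products requires. -/
theorem le_joint_tail
    (hδ : ∀ i ∈ R, (setBernoulli u p).real {H | t ≤ |(hitCount (A i ∩ (R.erase i).biUnion A) H : ℝ) -
      (A i ∩ (R.erase i).biUnion A).card * p|} ≤ δ)
    (hnn : ∀ i ∈ R, δ ≤ (setBernoulli u p).real {H | c + 2 * t < hitCount (A i) H}) :
    ∏ i ∈ R, ((setBernoulli u p).real {H | c + 2 * t < hitCount (A i) H} - δ) ≤
      (setBernoulli u p).real {H | ∀ i ∈ R, c < hitCount (A i) H} + R.card * δ := by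
  set C : ι → Finset α := fun i => (R.erase i).biUnion A with hC
  have h1 := setBernoulli_real_forall_hitCount (u := u) (p := p)
    (pairwiseDisjoint_sdiff_biUnion_erase A R)
    (fun i => {j : ℕ | c - (A i ∩ C i).card * p + t < j})
  have h2 : (setBernoulli u p).real {H | ∀ i ∈ R, hitCount (A i \ C i) H ∈
        {j : ℕ | c - (A i ∩ C i).card * p + t < j}} ≤
      (setBernoulli u p).real {H | ∀ i ∈ R, c < hitCount (A i) H} + R.card * δ := by
    refine measureReal_le_add_of_subset ?_ hδ
    intro H hH
    by_cases hbad : ∃ i ∈ R, t ≤ |(hitCount (A i ∩ C i) H : ℝ) - (A i ∩ C i).card * p|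
    · obtain ⟨i, hi, hb⟩ := hbad
      exact Or.inr (Set.mem_biUnion hi hb)
    · push Not at hbad
      refine Or.inl fun i hi => ?_
      have h3 : c - (A i ∩ C i).card * p + t < hitCount (A i \ C i) H := hH i hi
      have h4 := (abs_lt.1 (hbad i hi)).1
      rw [hitCount_eq_add (C := C i)]
      push_cast
      linarith
  rw [h1] at h2
  refine le_trans ?_ h2
  refine Finset.prod_le_prod (fun i hi => sub_nonneg.2 (hnn i hi)) fun i hi => ?_
  have h5 := measureReal_le_add_of_subset (μ := setBernoulli u p) (R := {i})
    (E := {H | c + 2 * t < hitCount (A i) H})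
    (F := {H | hitCount (A i \ C i) H ∈ {j : ℕ | c - (A i ∩ C i).card * p + t < j}})
    (G := fun i => {H | t ≤ |(hitCount (A i ∩ C i) H : ℝ) - (A i ∩ C i).card * p|}) (δ := δ)
    (fun H hH => by
      by_cases hbad : t ≤ |(hitCount (A i ∩ C i) H : ℝ) - (A i ∩ C i).card * p|
      · exact Or.inr (by simpa using hbad)
      · have h4 := (abs_lt.1 (not_le.1 hbad)).2
        have h3 : c + 2 * t < hitCount (A i) H := hH
        rw [hitCount_eq_add (C := C i)] at h3
        push_cast at h3
        refine Or.inl ?_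
        change c - (A i ∩ C i).card * p + t < hitCount (A i \ C i) H
        linarith)
    (fun j hj => by rw [Finset.mem_singleton] at hj; subst hj; exact hδ j hi)
  rw [Finset.card_singleton, Nat.cast_one, one_mul] at h5
  linarith

end Joint

/-! ### Bonferroni inequalities and Poisson limits -/

section Bonferroni

/-- If `w > 0` events occur, truncated inclusion-exclusion misses the true value `0` by a term whose
sign is that of the last summand. Bonferroni's inequalities are this fact integrated. -/
theorem alternating_sum_choose_eq (w m : ℕ) :
    ∑ r ∈ Finset.range (m + 1), (-1 : ℝ) ^ r * w.choose r =
      if w = 0 then 1 else (-1 : ℝ) ^ m * ((w - 1).choose m : ℝ) := by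
  rcases w with _ | w
  · rw [Finset.sum_range_succ']
    simp
  · have := Int.alternating_sum_range_choose_eq_choose (n := w) (m := m)
    simp only [Nat.add_eq_zero_iff, one_ne_zero, and_false, if_false]
    exact_mod_cast this

open Classical in
theorem indicator_forall_notMem {Ω ι : Type*} {D : Finset ι} {E : ι → Set Ω} (ω : Ω) :
    {ω | ∀ i ∈ D, ω ∉ E i}.indicator (1 : Ω → ℝ) ω =
      if (D.filter fun i => ω ∈ E i).card = 0 then 1 else 0 := by
  simp [Set.indicator_apply, Finset.filter_eq_empty_iff]

variable {Ω ι : Type*} [MeasurableSpace Ω]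

/-- The `r`-th binomial moment of the number of events `E i`, `i ∈ D`, that occur. -/
noncomputable def binomialMoment (μ : Measure Ω) (D : Finset ι) (E : ι → Set Ω) (r : ℕ) : ℝ :=
  ∑ R ∈ D.powersetCard r, μ.real {ω | ∀ i ∈ R, ω ∈ E i}

variable {μ : Measure Ω} [IsFiniteMeasure μ] {D : Finset ι} {E : ι → Set Ω}

open Classical in
-- `W.choose r` counts the `r`-sets of indices all of whose events occur, where `W` is the number of
-- occurring events; its integral is the binomial moment.
theorem integral_alternating_sum_choose (hE : ∀ i, MeasurableSet (E i)) (m : ℕ) :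
    ∑ r ∈ Finset.range m, (-1 : ℝ) ^ r * binomialMoment μ D E r =
      ∫ ω, ∑ r ∈ Finset.range m, (-1 : ℝ) ^ r * ((D.filter fun i => ω ∈ E i).card.choose r) ∂μ ∧
    Integrable (fun ω => ∑ r ∈ Finset.range m,
      (-1 : ℝ) ^ r * ((D.filter fun i => ω ∈ E i).card.choose r)) μ := by
  have hm : ∀ R : Finset ι, MeasurableSet {ω | ∀ i ∈ R, ω ∈ E i} := by
    intro R
    have : {ω | ∀ i ∈ R, ω ∈ E i} = ⋂ i ∈ R, E i := by ext; simp
    rw [this]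
    exact R.measurableSet_biInter fun i _ => hE i
  have hi : ∀ R : Finset ι, Integrable ({ω | ∀ i ∈ R, ω ∈ E i}.indicator (1 : Ω → ℝ)) μ :=
    fun R => (integrable_const (1 : ℝ)).indicator (hm R)
  have hc : ∀ ω r, ((D.filter fun i => ω ∈ E i).card.choose r : ℝ) =
      ∑ R ∈ D.powersetCard r, {ω | ∀ i ∈ R, ω ∈ E i}.indicator (1 : Ω → ℝ) ω := by
    intro ω r
    simp only [Set.indicator_apply, Set.mem_ofPred_eq, Pi.one_apply]
    rw [← Finset.card_powersetCard, Finset.sum_boole]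
    congr 2
    ext R
    simp only [Finset.mem_powersetCard, Finset.mem_filter, Finset.subset_iff]
    grind
  have hint : ∀ r, Integrable (fun ω => ∑ R ∈ D.powersetCard r,
      {ω | ∀ i ∈ R, ω ∈ E i}.indicator (1 : Ω → ℝ) ω) μ :=
    fun r => integrable_finsetSum _ fun R _ => hi R
  simp only [hc]
  refine ⟨?_, integrable_finsetSum _ fun r _ => (hint r).const_mul _⟩
  rw [integral_finsetSum _ fun r _ => (hint r).const_mul _]
  refine Finset.sum_congr rfl fun r _ => ?_
  rw [integral_const_mul, integral_finsetSum _ fun R _ => hi R, binomialMoment]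
  congr 1
  exact Finset.sum_congr rfl fun R _ => (integral_indicator_one (hm R)).symm

theorem measurableSet_forall_notMem (hE : ∀ i, MeasurableSet (E i)) :
    MeasurableSet {ω | ∀ i ∈ D, ω ∉ E i} := by
  have : {ω | ∀ i ∈ D, ω ∉ E i} = ⋂ i ∈ D, (E i)ᶜ := by ext; simp
  rw [this]
  exact D.measurableSet_biInter fun i _ => (hE i).compl

theorem bonferroni_le (hE : ∀ i, MeasurableSet (E i)) (m : ℕ) :
    μ.real {ω | ∀ i ∈ D, ω ∉ E i} ≤
      ∑ r ∈ Finset.range (2 * m + 1), (-1 : ℝ) ^ r * binomialMoment μ D E r := by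
  classical
  obtain ⟨h1, h2⟩ := integral_alternating_sum_choose (μ := μ) (D := D) hE (2 * m + 1)
  have hM := measurableSet_forall_notMem (D := D) hE
  rw [h1, ← integral_indicator_one hM]
  refine integral_mono ((integrable_const (1 : ℝ)).indicator hM) h2 fun ω => ?_
  simp only
  rw [alternating_sum_choose_eq, indicator_forall_notMem]
  split_ifs
  · rfl
  · rw [Even.neg_one_pow (even_two_mul m), one_mul]
    exact Nat.cast_nonneg _

theorem le_bonferroni (hE : ∀ i, MeasurableSet (E i)) (m : ℕ) :
    ∑ r ∈ Finset.range (2 * m + 1 + 1), (-1 : ℝ) ^ r * binomialMoment μ D E r ≤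
      μ.real {ω | ∀ i ∈ D, ω ∉ E i} := by
  classical
  obtain ⟨h1, h2⟩ := integral_alternating_sum_choose (μ := μ) (D := D) hE (2 * m + 1 + 1)
  have hM := measurableSet_forall_notMem (D := D) hE
  rw [h1, ← integral_indicator_one hM]
  refine integral_mono h2 ((integrable_const (1 : ℝ)).indicator hM) fun ω => ?_
  simp only
  rw [alternating_sum_choose_eq, indicator_forall_notMem]
  split_ifs
  · rfl
  · rw [Odd.neg_one_pow (odd_two_mul_add_one m), neg_one_mul]
    exact neg_nonpos.2 (Nat.cast_nonneg _)

end Bonferroni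

theorem tendsto_sum_pow_div_factorial (x : ℝ) :
    Tendsto (fun m => ∑ r ∈ Finset.range m, (-1 : ℝ) ^ r * (x ^ r / r.factorial)) atTop
      (𝓝 (Real.exp (-x))) := by
  have := (NormedSpace.expSeries_div_hasSum_exp (-x)).tendsto_sum_nat
  rw [← congrFun Real.exp_eq_exp_ℝ (-x)] at this
  refine this.congr fun m => Finset.sum_congr rfl fun r _ => ?_
  rw [neg_pow, mul_div_assoc]

/-- If all binomial moments of the number of occurring events converge to those of a Poisson law,
then so does the probability that no event occurs. -/
theorem tendsto_measureReal_forall_notMem {κ : Type*} {l : Filter κ} {Ω ι : κ → Type*}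
    [∀ n, MeasurableSpace (Ω n)] {μ : ∀ n, Measure (Ω n)} [∀ n, IsFiniteMeasure (μ n)]
    {D : ∀ n, Finset (ι n)} {E : ∀ n, ι n → Set (Ω n)} (hE : ∀ n i, MeasurableSet (E n i)) {x : ℝ}
    (h : ∀ r, Tendsto (fun n => binomialMoment (μ n) (D n) (E n) r) l (𝓝 (x ^ r / r.factorial))) :
    Tendsto (fun n => (μ n).real {ω | ∀ i ∈ D n, ω ∉ E n i}) l (𝓝 (Real.exp (-x))) := by
  have hsum : ∀ m, Tendsto (fun n => ∑ r ∈ Finset.range m,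
      (-1 : ℝ) ^ r * binomialMoment (μ n) (D n) (E n) r) l
      (𝓝 (∑ r ∈ Finset.range m, (-1 : ℝ) ^ r * (x ^ r / r.factorial))) :=
    fun m => tendsto_finsetSum _ fun r _ => (h r).const_mul _
  have hs := tendsto_sum_pow_div_factorial x
  have h2 : Tendsto (fun m => 2 * m) atTop atTop :=
    tendsto_id.const_mul_atTop' (two_pos : 0 < 2)
  have hodd := hs.comp (tendsto_atTop_mono (fun m => (by omega : 2 * m ≤ 2 * m + 1)) h2)
  have heven := hs.comp (tendsto_atTop_mono (fun m => (by omega : 2 * m ≤ 2 * m + 1 + 1)) h2)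
  rw [tendsto_order]
  constructor
  · intro a ha
    -- The truncation level is fixed before the limit in `n`, since the moments converge only for
    -- each fixed order.
    obtain ⟨m, hm⟩ := ((tendsto_order.1 heven).1 a ha).exists
    filter_upwards [(tendsto_order.1 (hsum (2 * m + 1 + 1))).1 a hm] with n hn
    exact hn.trans_le (le_bonferroni (hE n) m)
  · intro a ha
    obtain ⟨m, hm⟩ := ((tendsto_order.1 hodd).2 a ha).exists
    filter_upwards [(tendsto_order.1 (hsum (2 * m + 1))).2 a hm] with n hn
    exact (bonferroni_le (hE n) m).trans_lt hn

/-! ### Limit tools: squeezing, binomial coefficients, weak convergence. -/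

theorem tendsto_of_forall_pos_bounds {κ : Type*} {l : Filter κ} {f : κ → ℝ} {g : ℝ → ℝ}
    (hg : Continuous g)
    (hU : ∀ ε > 0, ∃ U : κ → ℝ, Tendsto U l (𝓝 (g ε)) ∧ ∀ᶠ n in l, f n ≤ U n)
    (hV : ∀ ε > 0, ∃ V : κ → ℝ, Tendsto V l (𝓝 (g (-ε))) ∧ ∀ᶠ n in l, V n ≤ f n) :
    Tendsto f l (𝓝 (g 0)) := by
  rw [tendsto_order]
  constructor
  · intro a ha
    have h0 : Tendsto (fun ε => g (-ε)) (𝓝[>] 0) (𝓝 (g (-0))) :=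
      ((hg.comp continuous_neg).tendsto 0).mono_left nhdsWithin_le_nhds
    rw [neg_zero] at h0
    obtain ⟨ε, h1, h2⟩ := (((tendsto_order.1 h0).1 a ha).and self_mem_nhdsWithin).exists
    obtain ⟨V, hV1, hV2⟩ := hV ε h2
    filter_upwards [hV2, (tendsto_order.1 hV1).1 a h1] with n h3 h4
    exact h4.trans_le h3
  · intro a ha
    have h0 : Tendsto g (𝓝[>] 0) (𝓝 (g 0)) := (hg.tendsto 0).mono_left nhdsWithin_le_nhds
    obtain ⟨ε, h1, h2⟩ := (((tendsto_order.1 h0).2 a ha).and self_mem_nhdsWithin).exists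
    obtain ⟨U, hU1, hU2⟩ := hU ε h2
    filter_upwards [hU2, (tendsto_order.1 hU1).2 a h1] with n h3 h4
    exact h3.trans_lt h4

/-- Since `C(d,r) ~ d^r/r!`, the power contributes `(dT + dδ)^r` and the union-bound term `r d^r δ`.
No sign is imposed on `δ`, so upper and lower joint tails are both covered. -/
theorem tendsto_choose_mul_pow_add {κ : Type*} {l : Filter κ} {d : κ → ℕ} {T δ : κ → ℝ} {x : ℝ}
    {r : ℕ} (hd : Tendsto d l atTop) (hT : Tendsto (fun n => d n * T n) l (𝓝 x))
    (hδ : Tendsto (fun n => d n * δ n) l (𝓝 0)) (hδr : Tendsto (fun n => d n ^ r * δ n) l (𝓝 0)) :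
    Tendsto (fun n => (d n).choose r * ((T n + δ n) ^ r + r * δ n)) l
      (𝓝 (x ^ r / r.factorial)) := by
  have hc : Tendsto (fun n : ℕ => (n.choose r : ℝ) / n ^ r) atTop (𝓝 (1 / r.factorial)) := by
    have h1 := ((isEquivalent_iff_tendsto_one (by
      filter_upwards [eventually_gt_atTop 0] with n hn
      positivity)).1 (isEquivalent_choose r)).mul_const (1 / (r.factorial : ℝ))
    rw [one_mul] at h1
    refine h1.congr' ?_
    filter_upwards [eventually_gt_atTop 0] with n hn
    simp only [Pi.div_apply]
    have : (0 : ℝ) < n := by exact_mod_cast hn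
    have : (0 : ℝ) < r.factorial := by exact_mod_cast r.factorial_pos
    field_simp
  have key := (hc.comp hd).mul (((hT.add hδ).pow r).add (hδr.const_mul (r : ℝ)))
  rw [add_zero, mul_zero, add_zero, one_div_mul_eq_div] at key
  refine key.congr' ?_
  filter_upwards [hd.eventually_gt_atTop 0] with n hn
  have : (0 : ℝ) < d n := by exact_mod_cast hn
  simp only [Function.comp]
  rw [← mul_add, mul_pow]
  field_simp

/-- Convergence of distribution functions at every point to a continuous one implies
weak convergence. -/
theorem tendsto_probabilityMeasure_of_tendsto_Iic {κ : Type*} {l : Filter κ}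
    [l.IsCountablyGenerated] {μ : κ → ProbabilityMeasure ℝ} {ν : ProbabilityMeasure ℝ}
    (h : ∀ x, Tendsto (fun n => (μ n : Measure ℝ).real (Set.Iic x)) l
      (𝓝 ((ν : Measure ℝ).real (Set.Iic x)))) :
    Tendsto μ l (𝓝 ν) := by
  -- Half-open intervals form a π-system containing arbitrarily small neighbourhoods of each point,
  -- and their measures are differences of distribution function values.
  refine (isPiSystem_Ioc (id : ℝ → ℝ) id).tendsto_probabilityMeasure_of_tendsto_of_mem ?_ ?_ ?_
  · rintro _ ⟨a, b, -, rfl⟩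
    exact measurableSet_Ioc
  · intro U hU x hx
    obtain ⟨ε, hε, hb⟩ := Metric.isOpen_iff.1 hU x hx
    refine ⟨Set.Ioc (x - ε / 2) (x + ε / 2), ⟨_, _, by simp only [id]; linarith, rfl⟩,
      Ioc_mem_nhds (by linarith) (by linarith), fun y hy => hb ?_⟩
    rw [Metric.mem_ball, Real.dist_eq, abs_lt]
    constructor <;> linarith [hy.1, hy.2]
  · rintro _ ⟨a, b, hab, rfl⟩
    have e : ∀ ρ : ProbabilityMeasure ℝ, ((ρ (Set.Ioc a b) : NNReal) : ℝ) =
        (ρ : Measure ℝ).real (Set.Iic b) - (ρ : Measure ℝ).real (Set.Iic a) := by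
      intro ρ
      rw [← Set.Iic_sdiff_Iic, ProbabilityMeasure.coeFn_def]
      exact measureReal_sdiff (Set.Iic_subset_Iic.2 hab.le) measurableSet_Iic
    rw [← NNReal.tendsto_coe]
    simp only [id, e]
    exact (h b).sub (h a)

/-! ### Extremal independence for weakly overlapping counts -/

section Extremal

open RandomHypergraph

/-- A bound for the probability that the count in an overlap of size `r * o` deviates from its mean
by `ε * scaling d N p`. -/
noncomputable def overlapError (r o N d : ℕ) (ε : ℝ) : ℝ :=
  2 * Real.exp (-((r + 2) * Real.log d) +
    (r + 2) ^ 2 * 2 * r / ε ^ 2 * (Real.log d * (o * Real.log d ^ 2 / N)))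

theorem setBernoulli_real_overlap_le {α : Type*} [Fintype α] {u : Set α} {p : I} {B : Finset α}
    (hB : (B : Set α) ⊆ u) {r o N d : ℕ} (hcard : B.card ≤ r * o) {ε : ℝ} (hε : 0 < ε)
    (hd : 0 < Real.log d) (hv : 0 < N * (p : ℝ) * (1 - p))
    (hx : (r + 2) * Real.log d / (ε * scaling d N p) ≤ 1) :
    (setBernoulli u p).real {H | ε * scaling d N p ≤ |(hitCount B H : ℝ) - B.card * p|} ≤
      overlapError r o N d ε := by
  have hq : (0 : ℝ) ≤ 1 - p := sub_nonneg.2 p.2.2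
  have hp := p.2.1
  have hs : 0 < scaling d N p := Real.sqrt_pos.2 (div_pos hv (by linarith))
  have h1 := setBernoulli_real_hitCount (p := p) hB
    {j : ℕ | ε * scaling d N p ≤ |(j : ℝ) - B.card * p|}
  -- The Chernoff parameter, read off from `hx`, is `(r + 2) log d / (ε b)`: the linear term of the
  -- exponent becomes exactly `-(r + 2) log d`.
  have h2 := binomial_real_abs_sub_le B.card p (t := ε * scaling d N p) (by positivity) hx
  rw [← h1] at h2
  refine h2.trans ?_
  unfold overlapError
  have hc : (B.card : ℝ) ≤ r * o := by exact_mod_cast hcard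
  gcongr ?_ * Real.exp (?_ + ?_)
  · rw [div_mul_cancel₀]
    positivity
  · have hss : scaling d N p ^ 2 = N * p * (1 - p) / (2 * Real.log d) :=
      Real.sq_sqrt (div_pos hv (by linarith)).le
    have hN : (N : ℝ) ≠ 0 := by rintro h; simp [h] at hv
    have hp' : (p : ℝ) ≠ 0 := by rintro h; simp [h] at hv
    have hq' : (1 - p : ℝ) ≠ 0 := by rintro h; simp [h] at hv
    calc _ ≤ ((r + 2) * Real.log d / (ε * scaling d N p)) ^ 2 * (r * o * p * (1 - p)) := by gcongr
      _ = _ := by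
        rw [div_pow, mul_pow ε, hss]
        field_simp

variable {κ : Type*} {l : Filter κ} {N o d : κ → ℕ} {p : κ → I}

/-- The exponent is `(j - (r + 2) + o(1)) log d`. The margin `r + 2` covers both `j = r` and `j =
1`, even when `r = 0`. -/
theorem tendsto_pow_mul_overlapError (hd : Tendsto d l atTop)
    (ho : Tendsto (fun n => o n * Real.log (d n) ^ 2 / N n) l (𝓝 0)) (r : ℕ) (ε : ℝ) {j : ℕ}
    (hj : j ≤ r + 1) :
    Tendsto (fun n => (d n : ℝ) ^ j * overlapError r (o n) (N n) (d n) ε) l (𝓝 0) := by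
  have ht : Tendsto (fun n => Real.log (d n)) l atTop :=
    Real.tendsto_log_atTop.comp (tendsto_natCast_atTop_atTop.comp hd)
  have h1 := (ho.const_mul ((r + 2 : ℝ) ^ 2 * 2 * r / ε ^ 2)).const_add ((j : ℝ) - (r + 2))
  rw [mul_zero, add_zero] at h1
  have hneg : (j : ℝ) - (r + 2) < 0 := by
    have : (j : ℝ) ≤ r + 1 := by exact_mod_cast hj
    linarith
  have h2 := (Real.tendsto_exp_atBot.comp (ht.atTop_mul_neg hneg h1)).const_mul 2
  rw [mul_zero] at h2
  refine h2.congr' ?_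
  filter_upwards [hd.eventually_gt_atTop 0] with n hn
  have hn' : (0 : ℝ) < d n := by exact_mod_cast hn
  have e : (d n : ℝ) ^ j = Real.exp (j * Real.log (d n)) := by
    rw [Real.exp_nat_mul, Real.exp_log hn']
  simp only [Function.comp]
  rw [e, overlapError, mul_left_comm, ← Real.exp_add]
  congr 2
  ring

/-- As `log d / b = √(2 log³ d / v)`, the moderate deviation condition also makes the Chernoff
parameter admissible. -/
theorem tendsto_div_scaling (hd : Tendsto d l atTop)
    (hv : Tendsto (fun n => N n * (p n : ℝ) * (1 - p n)) l atTop)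
    (hL : Tendsto (fun n => Real.log (d n) ^ 3 / (N n * (p n : ℝ) * (1 - p n))) l (𝓝 0))
    (c ε : ℝ) :
    Tendsto (fun n => c * Real.log (d n) / (ε * scaling (d n) (N n) (p n))) l (𝓝 0) := by
  have ht : Tendsto (fun n => Real.log (d n)) l atTop :=
    Real.tendsto_log_atTop.comp (tendsto_natCast_atTop_atTop.comp hd)
  have h := ((Real.continuous_sqrt.tendsto _).comp (hL.const_mul 2)).const_mul (c / ε)
  rw [mul_zero, Real.sqrt_zero, mul_zero] at h
  refine h.congr' ?_
  filter_upwards [ht.eventually_gt_atTop 0, hv.eventually_gt_atTop 0] with n htn hvn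
  have e : √(2 * (Real.log (d n) ^ 3 / (N n * (p n : ℝ) * (1 - p n)))) =
      Real.log (d n) / scaling (d n) (N n) (p n) := by
    rw [scaling]
    nth_rewrite 2 [← Real.sqrt_sq htn.le]
    rw [← Real.sqrt_div (by positivity)]
    congr 1
    generalize N n * (p n : ℝ) * (1 - p n) = v at *
    field_simp
  simp only [Function.comp]
  rw [e]
  ring

/-- Needed because `⌊c⌋₊` is `0` for negative `c`, where `c < X` would no longer match `⌊c⌋₊ + 1 ≤
X`. -/
theorem eventually_threshold_nonneg (hp : ∀ᶠ n in l, 0 < (p n : ℝ) ∧ (p n : ℝ) < 1)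
    (hd : Tendsto d l atTop) (x : ℝ) :
    ∀ᶠ n in l, 0 ≤ centring (d n) (N n) (p n) + scaling (d n) (N n) (p n) * x := by
  have ht : Tendsto (fun n => Real.log (d n)) l atTop :=
    Real.tendsto_log_atTop.comp (tendsto_natCast_atTop_atTop.comp hd)
  filter_upwards [hp, ht.eventually_gt_atTop 0, (tendsto_order.1
    ((tendsto_standardThreshold_div_sqrt x).comp ht)).1 0 one_pos] with n hpn htn hz
  rw [centring_add_scaling_mul hpn.1.le hpn.2.le htn]
  have : 0 < standardThreshold x (Real.log (d n)) :=
    (div_pos_iff_of_pos_right (Real.sqrt_pos.2 (by linarith))).1 hz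
  have := hpn.1
  positivity

variable {α ι : κ → Type*} [∀ n, Fintype (α n)] [∀ n, DecidableEq (α n)] [∀ n, DecidableEq (ι n)]
  {u : ∀ n, Set (α n)} {D : ∀ n, Finset (ι n)} {A : ∀ n, ι n → Finset (α n)}

theorem setBernoulli_real_lt_hitCount {β : Type*} [Fintype β] {w : Set β} {q : I} {B : Finset β}
    (hB : (B : Set β) ⊆ w) {c : ℝ} (hc : 0 ≤ c) :
    (setBernoulli w q).real {H | c < hitCount B H} = binomialTail B.card q (⌊c⌋₊ + 1) := by
  rw [← binomial_real_le_eq_binomialTail, ← setBernoulli_real_hitCount hB]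
  congr 1
  ext H
  exact (Nat.floor_lt hc).symm

/-- Taking `t = ε b` in the joint tail bounds replaces `x` by `x ∓ 2ε`. Each of the `C(d,r)` joint
probabilities is thus squeezed between near-products of single tails, and `ε → 0` closes the gap. -/
theorem tendsto_binomialMoment_hitCount (hp : ∀ᶠ n in l, 0 < (p n : ℝ) ∧ (p n : ℝ) < 1)
    (hd : Tendsto d l atTop)
    (hv : Tendsto (fun n => N n * (p n : ℝ) * (1 - p n)) l atTop)
    (hL : Tendsto (fun n => Real.log (d n) ^ 3 / (N n * (p n : ℝ) * (1 - p n))) l (𝓝 0))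
    (ho : Tendsto (fun n => o n * Real.log (d n) ^ 2 / N n) l (𝓝 0))
    (hD : ∀ᶠ n in l, (D n).card = d n)
    (hA : ∀ᶠ n in l, ∀ i ∈ D n, ((A n i : Finset (α n)) : Set (α n)) ⊆ u n ∧ (A n i).card = N n)
    (hAA : ∀ᶠ n in l, ∀ i ∈ D n, ∀ j ∈ D n, i ≠ j → (A n i ∩ A n j).card ≤ o n)
    (x : ℝ) (r : ℕ) :
    Tendsto (fun n => binomialMoment (setBernoulli (u n) (p n)) (D n)
      (fun i => {H | centring (d n) (N n) (p n) + scaling (d n) (N n) (p n) * x <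
        hitCount (A n i) H}) r) l (𝓝 (Real.exp (-x) ^ r / r.factorial)) := by
  set c : ℝ → κ → ℝ := fun y n =>
    centring (d n) (N n) (p n) + scaling (d n) (N n) (p n) * y with hc
  set T : ℝ → κ → ℝ := fun y n => binomialTail (N n) (p n) (⌊c y n⌋₊ + 1) with hT
  have hTlim : ∀ y, Tendsto (fun n => d n * T y n) l (𝓝 (Real.exp (-y))) :=
    fun y => tendsto_mul_binomialTail_threshold hp hd hv hL y
  have hTeq : ∀ y, ∀ᶠ n in l, ∀ i ∈ D n,
      (setBernoulli (u n) (p n)).real {H | c y n < hitCount (A n i) H} = T y n := by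
    intro y
    filter_upwards [eventually_threshold_nonneg hp hd y, hA] with n h1 h2 i hi
    rw [setBernoulli_real_lt_hitCount (h2 i hi).1 h1, (h2 i hi).2]
  have ht : Tendsto (fun n => Real.log (d n)) l atTop :=
    Real.tendsto_log_atTop.comp (tendsto_natCast_atTop_atTop.comp hd)
  have hover : ∀ ε > 0, ∀ᶠ n in l, ∀ R ∈ (D n).powersetCard r, ∀ i ∈ R,
      (setBernoulli (u n) (p n)).real {H | ε * scaling (d n) (N n) (p n) ≤
        |(hitCount (A n i ∩ (R.erase i).biUnion (A n)) H : ℝ) -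
          (A n i ∩ (R.erase i).biUnion (A n)).card * p n|} ≤
        overlapError r (o n) (N n) (d n) ε := by
    intro ε hε
    filter_upwards [ht.eventually_gt_atTop 0, hv.eventually_gt_atTop 0, hA, hAA,
      (tendsto_order.1 (tendsto_div_scaling hd hv hL (r + 2) ε)).2 1 one_pos]
      with n h1 h2 h3 h4 h5 R hR i hi
    rw [Finset.mem_powersetCard] at hR
    refine setBernoulli_real_overlap_le ?_ ?_ hε h1 h2 h5.le
    · exact (Finset.coe_subset.2 Finset.inter_subset_left).trans (h3 i (hR.1 hi)).1
    · rw [Finset.inter_biUnion]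
      refine Finset.card_biUnion_le.trans ((Finset.sum_le_card_nsmul _ _ (o n) ?_).trans ?_)
      · intro j hj
        rw [Finset.mem_erase] at hj
        exact h4 i (hR.1 hi) j (hR.1 hj.2) hj.1.symm
      · rw [smul_eq_mul, ← hR.2]
        exact Nat.mul_le_mul_right _ (Finset.card_le_card (Finset.erase_subset _ _))
  have hg : Continuous fun ε : ℝ => Real.exp (-(x - 2 * ε)) ^ r / r.factorial := by fun_prop
  have key := tendsto_of_forall_pos_bounds (l := l) (f := fun n =>
    binomialMoment (setBernoulli (u n) (p n)) (D n) (fun i => {H | c x n < hitCount (A n i) H}) r)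
    hg ?_ ?_
  · simpa using key
  · intro ε hε
    set δ : κ → ℝ := fun n => overlapError r (o n) (N n) (d n) ε with hδ
    refine ⟨fun n => (d n).choose r * ((T (x - 2 * ε) n + δ n) ^ r + r * δ n),
      tendsto_choose_mul_pow_add hd (hTlim _)
        (by simpa using tendsto_pow_mul_overlapError hd ho r ε (j := 1) (by omega))
        (tendsto_pow_mul_overlapError hd ho r ε (by omega)), ?_⟩
    filter_upwards [hover ε hε, hTeq (x - 2 * ε), hD] with n h1 h2 h3
    rw [binomialMoment, ← h3, ← Finset.card_powersetCard, ← nsmul_eq_mul]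
    refine Finset.sum_le_card_nsmul _ _ _ fun R hR => ?_
    refine (joint_tail_le (h1 R hR)).trans (le_of_eq ?_)
    rw [Finset.mem_powersetCard] at hR
    rw [hR.2, Finset.prod_congr rfl (g := fun _ => T (x - 2 * ε) n + δ n), Finset.prod_const, hR.2]
    intro i hi
    rw [← h2 i (hR.1 hi)]
    simp only [hc]
    congr 4
    ext H
    rw [show centring (d n) (N n) (p n) + scaling (d n) (N n) (p n) * x -
      2 * (ε * scaling (d n) (N n) (p n)) = centring (d n) (N n) (p n) +
        scaling (d n) (N n) (p n) * (x - 2 * ε) by ring]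
  · intro ε hε
    set δ : κ → ℝ := fun n => overlapError r (o n) (N n) (d n) ε with hδ
    have hδ1 : Tendsto (fun n => d n * δ n) l (𝓝 0) := by
      simpa using tendsto_pow_mul_overlapError hd ho r ε (j := 1) (by omega)
    have hδr : Tendsto (fun n => (d n : ℝ) ^ r * δ n) l (𝓝 0) :=
      tendsto_pow_mul_overlapError hd ho r ε (by omega)
    refine ⟨fun n => (d n).choose r * ((T (x - 2 * -ε) n + -δ n) ^ r + r * -δ n),
      tendsto_choose_mul_pow_add hd (hTlim _) (by simpa using hδ1.neg) (by simpa using hδr.neg), ?_⟩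
    -- The tail has order exactly `1/d`, while `d δ → 0`.
    have hlt : ∀ᶠ n in l, δ n ≤ T (x - 2 * -ε) n := by
      have := (hTlim (x - 2 * -ε)).sub hδ1
      rw [sub_zero] at this
      filter_upwards [(tendsto_order.1 this).1 0 (Real.exp_pos _)] with n hn
      rw [← mul_sub] at hn
      exact (sub_pos.1 (pos_of_mul_pos_right hn (Nat.cast_nonneg _))).le
    filter_upwards [hover ε hε, hTeq (x - 2 * -ε), hD, hlt] with n h1 h2 h3 h4
    have h2' : ∀ i ∈ D n, (setBernoulli (u n) (p n)).real
        {H | c x n + 2 * (ε * scaling (d n) (N n) (p n)) < hitCount (A n i) H} =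
          T (x - 2 * -ε) n := by
      intro i hi
      rw [← h2 i hi, show c (x - 2 * -ε) n = c x n + 2 * (ε * scaling (d n) (N n) (p n)) by
        simp only [hc]; ring]
    rw [binomialMoment, ← h3, ← Finset.card_powersetCard, ← nsmul_eq_mul]
    refine Finset.card_nsmul_le_sum _ _ _ fun R hR => ?_
    have hR' := Finset.mem_powersetCard.1 hR
    have h5 := le_joint_tail (c := c x n) (h1 R hR) fun i hi => by
      rw [h2' i (hR'.1 hi)]; exact h4
    rw [hR'.2, Finset.prod_congr rfl (g := fun _ => T (x - 2 * -ε) n + -δ n) (fun i hi => by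
      rw [h2' i (hR'.1 hi), ← sub_eq_add_neg]), Finset.prod_const, hR'.2] at h5
    have h6 := sub_le_iff_le_add.2 h5
    rwa [sub_eq_add_neg, ← mul_neg] at h6

/-- The maximum of the counts in `d` sets of `N` elements each with small pairwise overlaps
has the same Gumbel limit as the maximum of `d` independent binomial variables. -/
theorem tendsto_setBernoulli_real_forall_hitCount_le
    (hp : ∀ᶠ n in l, 0 < (p n : ℝ) ∧ (p n : ℝ) < 1) (hd : Tendsto d l atTop)
    (hv : Tendsto (fun n => N n * (p n : ℝ) * (1 - p n)) l atTop)
    (hL : Tendsto (fun n => Real.log (d n) ^ 3 / (N n * (p n : ℝ) * (1 - p n))) l (𝓝 0))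
    (ho : Tendsto (fun n => o n * Real.log (d n) ^ 2 / N n) l (𝓝 0))
    (hD : ∀ᶠ n in l, (D n).card = d n)
    (hA : ∀ᶠ n in l, ∀ i ∈ D n, ((A n i : Finset (α n)) : Set (α n)) ⊆ u n ∧ (A n i).card = N n)
    (hAA : ∀ᶠ n in l, ∀ i ∈ D n, ∀ j ∈ D n, i ≠ j → (A n i ∩ A n j).card ≤ o n) (x : ℝ) :
    Tendsto (fun n => (setBernoulli (u n) (p n)).real {H | ∀ i ∈ D n, (hitCount (A n i) H : ℝ) ≤
      centring (d n) (N n) (p n) + scaling (d n) (N n) (p n) * x}) l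
        (𝓝 (Real.exp (-Real.exp (-x)))) := by
  have := tendsto_measureReal_forall_notMem (fun n i => .of_discrete)
    fun r => tendsto_binomialMoment_hitCount hp hd hv hL ho hD hA hAA x r
  simpa only [Set.mem_ofPred_eq, not_lt] using this

end Extremal

/-! ### Codegrees of the binomial random hypergraph -/

section Codegree

open RandomHypergraph

/-- The `k`-subsets of the vertex set that contain `S`. -/
def potentialEdges {n : ℕ} (k : ℕ) (S : Finset (Fin n)) : Finset (Finset (Fin n)) :=
  Finset.univ.filter fun e => e.card = k ∧ S ⊆ e

theorem mem_potentialEdges {n k : ℕ} {S e : Finset (Fin n)} :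
    e ∈ potentialEdges k S ↔ e.card = k ∧ S ⊆ e := by
  simp [potentialEdges]

theorem card_potentialEdges {n k : ℕ} {S : Finset (Fin n)} (h : S.card ≤ k) :
    (potentialEdges k S).card = (n - S.card).choose (k - S.card) := by
  have hc : Sᶜ.card = n - S.card := by rw [Finset.card_compl, Fintype.card_fin]
  rw [← hc, ← Finset.card_powersetCard]
  refine Finset.card_nbij' (fun e => e \ S) (fun e => e ∪ S) ?_ ?_ ?_ ?_
  · intro e he
    rw [Finset.mem_coe, mem_potentialEdges] at he
    rw [Finset.mem_coe, Finset.mem_powersetCard, Finset.card_sdiff_of_subset he.2, he.1]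
    exact ⟨fun v hv => Finset.mem_compl.2 (Finset.mem_sdiff.1 hv).2, rfl⟩
  · intro e he
    rw [Finset.mem_coe, Finset.mem_powersetCard] at he
    rw [Finset.mem_coe, mem_potentialEdges, Finset.card_union_of_disjoint
      (Finset.disjoint_left.2 fun v hv => Finset.mem_compl.1 (he.1 hv)), he.2]
    exact ⟨by omega, Finset.subset_union_right⟩
  · intro e he
    rw [Finset.mem_coe, mem_potentialEdges] at he
    exact Finset.sdiff_union_of_subset he.2
  · intro e he
    rw [Finset.mem_coe, Finset.mem_powersetCard] at he
    exact Finset.union_sdiff_cancel_right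
      (Finset.disjoint_left.2 fun v hv => Finset.mem_compl.1 (he.1 hv))

/-- Some vertex `v` of `T` is outside `S`, and a common edge contains `insert v S`, a set of `s + 1`
vertices. -/
theorem card_potentialEdges_inter_le {n k s : ℕ} {S T : Finset (Fin n)} (hS : S.card = s)
    (hT : T.card = s) (hne : S ≠ T) (hsk : s < k) :
    (potentialEdges k S ∩ potentialEdges k T).card ≤ (n - s - 1).choose (k - s - 1) := by
  obtain ⟨v, hvT, hvS⟩ : ∃ v ∈ T, v ∉ S := by
    by_contra! hcon
    exact hne (Finset.eq_of_subset_of_card_le hcon (by omega)).symm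
  have hc : (insert v S).card = s + 1 := by rw [Finset.card_insert_of_notMem hvS, hS]
  have h := card_potentialEdges (k := k) (S := insert v S) (by omega)
  rw [hc, ← Nat.sub_sub, ← Nat.sub_sub] at h
  rw [← h]
  refine Finset.card_le_card fun e he => ?_
  rw [Finset.mem_inter, mem_potentialEdges, mem_potentialEdges] at he
  rw [mem_potentialEdges]
  exact ⟨he.1.1, Finset.insert_subset (he.2.2 hvT) he.1.2⟩

theorem codegree_eq_hitCount {n k : ℕ} {H : Set (Finset (Fin n))} (hH : H ⊆ {e | e.card = k})
    (S : Finset (Fin n)) : codegree H S = hitCount (potentialEdges k S) H := by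
  unfold codegree hitCount
  congr 1
  ext e
  simp only [Set.mem_ofPred_eq, Set.mem_inter_iff, Finset.mem_coe, mem_potentialEdges]
  exact ⟨fun h => ⟨h.1, hH h.1, h.2⟩, fun h => ⟨h.1, h.2.2⟩⟩

theorem maxCodegree_le_iff {n s : ℕ} {H : Set (Finset (Fin n))} {c : ℝ} (hc : 0 ≤ c) :
    (maxCodegree s H : ℝ) ≤ c ↔
      ∀ S ∈ (Finset.univ : Finset (Fin n)).powersetCard s, (codegree H S : ℝ) ≤ c := by
  rw [← Nat.le_floor_iff hc, maxCodegree, Finset.sup_le_iff]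
  exact forall₂_congr fun S _ => Nat.le_floor_iff hc

theorem binomialRandom_real_maxCodegree {n k s : ℕ} {p : I} {a b x : ℝ} (hb : 0 < b)
    (hc : 0 ≤ a + b * x) :
    (binomialRandom n k p).real {H | ((maxCodegree s H : ℝ) - a) / b ≤ x} =
      (setBernoulli {e : Finset (Fin n) | e.card = k} p).real
        {H | ∀ S ∈ (Finset.univ : Finset (Fin n)).powersetCard s,
          (hitCount (potentialEdges k S) H : ℝ) ≤ a + b * x} := by
  unfold binomialRandom
  refine measureReal_congr ?_
  -- `codegree` counts members of `H` of any size and `hitCount` only `k`-sets; they agree because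
  -- almost surely `H` consists of `k`-sets.
  filter_upwards [setBernoulli_ae_subset] with H hH
  refine propext ?_
  change ((maxCodegree s H : ℝ) - a) / b ≤ x ↔ ∀ S ∈ _, _
  rw [div_le_iff₀ hb, sub_le_iff_le_add', mul_comm, maxCodegree_le_iff hc]
  exact forall₂_congr fun S _ => by rw [codegree_eq_hitCount hH]

end Codegree

/-! ### Growth of the parameters -/

section Growth

theorem le_choose_of_pos_of_lt {n s : ℕ} (h1 : 1 ≤ s) (h2 : s < n) : n ≤ n.choose s := by
  induction n generalizing s with
  | zero => omega
  | succ n ih =>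
    obtain ⟨s, rfl⟩ : ∃ t, s = t + 1 := ⟨s - 1, by omega⟩
    rw [Nat.choose_succ_succ']
    rcases (by omega : s + 1 = n ∨ s + 1 < n) with h | h
    · subst h
      rw [Nat.choose_self, Nat.choose_succ_self_right]
    · have := ih (s := s + 1) (by omega) h
      have := Nat.choose_pos (n := n) (k := s) (by omega)
      omega

theorem log_choose_le (n s : ℕ) : Real.log (n.choose s) ≤ s * Real.log n := by
  rcases (n.choose s).eq_zero_or_pos with h | h
  · rw [h, Nat.cast_zero, Real.log_zero]
    exact mul_nonneg (Nat.cast_nonneg _) (Real.log_natCast_nonneg _)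
  · rw [← Real.log_pow]
    exact Real.log_le_log (by exact_mod_cast h) (by exact_mod_cast Nat.choose_le_pow n s)

/-- This relative overlap, together with `log d ≤ s log n`, turns the second growth hypothesis into
the overlap condition. -/
theorem choose_pred_div_choose {n k s : ℕ} (hsk : s < k) (hkn : k ≤ n) :
    ((n - s - 1).choose (k - s - 1) : ℝ) / ((n - s).choose (k - s) : ℝ) =
      ((k : ℝ) - s) / ((n : ℝ) - s) := by
  obtain ⟨j, rfl⟩ : ∃ j, k = s + j + 1 := ⟨k - s - 1, by omega⟩
  obtain ⟨m, rfl⟩ : ∃ m, n = s + m + 1 := ⟨n - s - 1, by omega⟩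
  rw [show s + m + 1 - s = m + 1 by omega, show s + j + 1 - s = j + 1 by omega,
    Nat.add_sub_cancel, Nat.add_sub_cancel]
  have h : ((m + 1 : ℕ) : ℝ) * m.choose j = (m + 1).choose (j + 1) * ((j + 1 : ℕ) : ℝ) := by
    exact_mod_cast Nat.add_one_mul_choose_eq m j
  have hpos : (0 : ℝ) < (m + 1).choose (j + 1) := by
    exact_mod_cast Nat.choose_pos (by omega)
  push_cast at h ⊢
  have hm : (s : ℝ) + m + 1 - s = m + 1 := by ring
  have hj : (s : ℝ) + j + 1 - s = j + 1 := by ring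
  rw [hm, hj, div_eq_div_iff hpos.ne' (by positivity)]
  linarith

variable {p : ℕ → I} {s k : ℕ → ℕ}

theorem tendsto_choose_atTop (hs : ∀ᶠ n in atTop, 1 ≤ s n ∧ s n ≤ n - 1) :
    Tendsto (fun n : ℕ => n.choose (s n)) atTop atTop := by
  refine tendsto_atTop_mono' _ ?_ tendsto_id
  filter_upwards [hs, eventually_gt_atTop 0] with n hn h0
  exact le_choose_of_pos_of_lt hn.1 (show s n < n by omega)

theorem binomial_variance_nonneg (N : ℕ) (q : I) : 0 ≤ N * (q : ℝ) * (1 - q) :=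
  mul_nonneg (mul_nonneg (Nat.cast_nonneg _) q.2.1) (sub_nonneg.2 q.2.2)

theorem tendsto_variance_atTop (hs : ∀ᶠ n in atTop, 1 ≤ s n ∧ s n ≤ n - 1)
    (hN : (fun n : ℕ => (s n : ℝ) ^ 3 * Real.log n ^ 3) =o[atTop]
      (fun n : ℕ => ((n - s n).choose (k n - s n) : ℝ) * (p n : ℝ) * (1 - (p n : ℝ)))) :
    Tendsto (fun n : ℕ => ((n - s n).choose (k n - s n) : ℝ) * (p n : ℝ) * (1 - (p n : ℝ)))
      atTop atTop := by
  have hlog : Tendsto (fun n : ℕ => Real.log n ^ 3) atTop atTop :=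
    (tendsto_pow_atTop (by norm_num)).comp (Real.tendsto_log_atTop.comp tendsto_natCast_atTop_atTop)
  refine tendsto_atTop_mono' _ ?_ hlog
  filter_upwards [hs, hN.bound one_pos] with n hn h
  have hl := Real.log_natCast_nonneg n
  have hs1 : (1 : ℝ) ≤ s n := by exact_mod_cast hn.1
  rw [Real.norm_of_nonneg (by positivity), Real.norm_of_nonneg (binomial_variance_nonneg _ _), one_mul] at h
  refine le_trans ?_ h
  exact le_mul_of_one_le_left (by positivity) (one_le_pow₀ hs1)

theorem tendsto_log_choose_cube_div
    (hN : (fun n : ℕ => (s n : ℝ) ^ 3 * Real.log n ^ 3) =o[atTop]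
      (fun n : ℕ => ((n - s n).choose (k n - s n) : ℝ) * (p n : ℝ) * (1 - (p n : ℝ)))) :
    Tendsto (fun n : ℕ => Real.log (n.choose (s n)) ^ 3 /
      (((n - s n).choose (k n - s n) : ℝ) * (p n : ℝ) * (1 - (p n : ℝ)))) atTop (𝓝 0) := by
  refine squeeze_zero' ?_ ?_ hN.tendsto_div_nhds_zero
  · refine Eventually.of_forall fun n => div_nonneg ?_ (binomial_variance_nonneg _ _)
    exact pow_nonneg (Real.log_natCast_nonneg _) _
  · refine Eventually.of_forall fun n => ?_
    rw [← mul_pow]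
    have := binomial_variance_nonneg ((n - s n).choose (k n - s n)) (p n)
    have := Real.log_natCast_nonneg (n.choose (s n))
    gcongr
    exact log_choose_le _ _

theorem tendsto_overlap_mul_log_sq (hk : ∀ᶠ n in atTop, s n < k n ∧ k n ≤ n)
    (hks : (fun n : ℕ => ((k n : ℝ) - (s n : ℝ)) * (s n : ℝ) ^ 2) =o[atTop]
      (fun n : ℕ => ((n : ℝ) - (s n : ℝ)) / Real.log n ^ 2)) :
    Tendsto (fun n : ℕ => ((n - s n - 1).choose (k n - s n - 1) : ℝ) *
      Real.log (n.choose (s n)) ^ 2 / ((n - s n).choose (k n - s n) : ℝ)) atTop (𝓝 0) := by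
  refine squeeze_zero' ?_ ?_ hks.tendsto_div_nhds_zero
  · exact Eventually.of_forall fun n => by positivity
  · filter_upwards [hk] with n hn
    have h1 : (s n : ℝ) < k n := by exact_mod_cast hn.1
    have h2 : (k n : ℝ) ≤ n := by exact_mod_cast hn.2
    have h3 : 0 ≤ ((k n : ℝ) - s n) / ((n : ℝ) - s n) :=
      div_nonneg (by linarith) (by linarith)
    have := Real.log_natCast_nonneg (n.choose (s n))
    rw [mul_div_right_comm, choose_pred_div_choose hn.1 hn.2, div_div_eq_mul_div, mul_assoc,
      ← mul_pow, mul_div_right_comm]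
    gcongr
    exact log_choose_le _ _

end Growth

/-! ### Conclusion: the Gumbel limit of the maximum codegree. -/

theorem mainTheorem5 (p : ℕ → unitInterval) (s k : ℕ → ℕ)
    (hp : ∀ᶠ n in atTop, 0 < (p n : ℝ) ∧ (p n : ℝ) < 1)
    (hs : ∀ᶠ n in atTop, 1 ≤ s n ∧ s n ≤ n - 1)
    (hk : ∀ᶠ n in atTop, s n < k n ∧ k n ≤ n)
    (hN : (fun n : ℕ => (s n : ℝ) ^ 3 * Real.log n ^ 3) =o[atTop]
      (fun n : ℕ => ((n - s n).choose (k n - s n) : ℝ) * (p n : ℝ) * (1 - (p n : ℝ))))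
    (hks : (fun n : ℕ => ((k n : ℝ) - (s n : ℝ)) * (s n : ℝ) ^ 2) =o[atTop]
      (fun n : ℕ => ((n : ℝ) - (s n : ℝ)) / Real.log n ^ 2)) :
    TendstoInDistribution
      (fun (n : ℕ) (H : Set (Finset (Fin n))) =>
        ((RandomHypergraph.maxCodegree (s n) H : ℝ)
            - RandomHypergraph.centring (n.choose (s n)) ((n - s n).choose (k n - s n)) (p n))
          / RandomHypergraph.scaling (n.choose (s n)) ((n - s n).choose (k n - s n)) (p n))
      atTop (id : ℝ → ℝ)
      (fun n => RandomHypergraph.binomialRandom n (k n) (p n))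
      RandomHypergraph.gumbelMeasure := by
  have hd := tendsto_choose_atTop hs
  have hv := tendsto_variance_atTop hs hN
  refine ⟨fun n => Measurable.aemeasurable .of_discrete, aemeasurable_id, ?_⟩
  refine tendsto_probabilityMeasure_of_tendsto_Iic fun x => ?_
  have key := tendsto_setBernoulli_real_forall_hitCount_le
    (α := fun n => Finset (Fin n)) (ι := fun n => Finset (Fin n))
    (u := fun n => {e : Finset (Fin n) | e.card = k n})
    (D := fun n => (Finset.univ : Finset (Fin n)).powersetCard (s n))
    (A := fun n S => potentialEdges (k n) S)
    (o := fun n => (n - s n - 1).choose (k n - s n - 1))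
    hp hd hv (tendsto_log_choose_cube_div hN) (tendsto_overlap_mul_log_sq hk hks)
    (Eventually.of_forall fun n => by rw [Finset.card_powersetCard, Finset.card_univ,
      Fintype.card_fin])
    (by
      filter_upwards [hk] with n hn S hS
      have hS' := (Finset.mem_powersetCard.1 hS).2
      refine ⟨fun e he => (mem_potentialEdges.1 he).1, ?_⟩
      rw [card_potentialEdges (by omega), hS'])
    (by
      filter_upwards [hk] with n hn S hS T hT hne
      exact card_potentialEdges_inter_le (Finset.mem_powersetCard.1 hS).2
        (Finset.mem_powersetCard.1 hT).2 hne hn.1) x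
  have hlim : (RandomHypergraph.gumbelMeasure.map id).real (Set.Iic x) =
      Real.exp (-Real.exp (-x)) := by
    rw [Measure.map_id, ← cdf_eq_real, RandomHypergraph.cdf_gumbelMeasure]
  simp only [ProbabilityMeasure.coe_mk, hlim]
  refine key.congr' ?_
  have ht : Tendsto (fun n : ℕ => Real.log (n.choose (s n))) atTop atTop :=
    Real.tendsto_log_atTop.comp (tendsto_natCast_atTop_atTop.comp hd)
  -- Rewriting the normalised event as a bound on all counts needs a positive scale and a
  -- nonnegative threshold, which hold only eventually.
  filter_upwards [eventually_threshold_nonneg hp hd x, hv.eventually_gt_atTop 0,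
    ht.eventually_gt_atTop 0] with n h1 h2 h3
  rw [map_measureReal_apply .of_discrete measurableSet_Iic]
  exact (binomialRandom_real_maxCodegree (Real.sqrt_pos.2 (div_pos h2 (by linarith))) h1).symm
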